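/- **Setting.** Let $Z$ be a random vector in $\mathbb{R}^q$ with law $P_0\ll\mu$, where $\mu$ is a fixed $\sigma$-finite dominating measure. Let $X^{(1)},\dots,X^{(J)}$ be subvectors of $Z$ (possibly empty), let $X$ be the vector of all components of $Z$ occurring in one of them, let $\Theta\subset\mathbb{R}^d$, and let $g_j:\mathbb{R}^q\times\mathbb{R}^d\to\mathbb{R}^{p_j}$ be measurable in the first argument. The model $\mathcal P$ is the set of pairs $(\theta,P)$ with $\theta\in\Theta$, $P\ll\mu$ a probability, $g_j(\cdot,\theta)\in L^1(P)$ and $E_P[g_j(Z,\theta)\mid X^{(j)}]=0$ $P$-a.s., $j=1,\dots,J$. Let $(\theta_0,P_0)\in\mathcal P$, let $g_j=g_j(Z,\theta_0)$ be square integrable, and let the conditional variances of the components of $g_j$ given $X^{(j)}$ be essentially bounded; $E$ denotes expectation under $P_0$. Let $w_1,w_2,\dots\in L^2(P_0)$ have dense linear span in $L^2(P_0)$, and let $g_k^w(Z,\theta)$ be the vector with components $E[w_s(Z)\mid X^{(j)}]\,g_{j,i}(Z,\theta)$, $1\le s\le k$, $1\le j\le J$, $1\le i\le p_j$. The model $\mathcal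 P_k$ is the set of pairs $(\theta,P)$ with $\theta\in\Theta$, $P\ll\mu$ a probability, $g^w_k(\cdot,\theta)\in L^1(P)$ and $E_P[g_k^w(Z,\theta)]=0$. The *moment functions* are $g=(g_1',\dots,g_J')'$ for $\mathcal P$ and $g_k^w$ for $\mathcal P_k$. **Information.** A *regular submodel* of one of these models, with moment functions $m$, is a family $u\mapsto(\theta_u,P_u)$, $u$ in a neighbourhood of $0$ in some $\mathbb{R}^r$, in the model, with $(\theta_u,P_u)=(\theta_0,P_0)$ at $u=0$, such that $u\mapsto\theta_u$ is differentiable at $0$; $P_u$ is differentiable in quadratic mean at $0$ with a score $S\in L^2(P_0)^r$, i.e. $\|\sqrt{p_u}-\sqrt{p_0}-\tfrac12 u'S\sqrt{p_0}\|_{L^2(\mu)}=o(|u|)$ for the $\mu$-densities; $E_{P_u}|m(Z,\theta_u)|^2$ is bounded near $u=0$; and $m(Z,\theta_u)\to m(Z,\theta_0)$ in $L^2(P_0)$ as $u\to0$. The tangent space is the closed linear span in $L^2(P_0)$ of the scores of all regular one-dimensional submodels. The efficient influence function is the vector $\tilde\psi$ with components in the tangent space such that $\frac{d}{dt}\theta_t|_{t=0}=E[\tilde\psi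 s]$ for every regular one-dimensional submodel, $s$ being its score; if it exists and $E[\tilde\psi\tilde\psi']$ is nonsingular, the information on $\theta_0$ at $P_0$ in the model is $E[\tilde\psi\tilde\psi']^{-1}$. **Assumption T.** There is a measurable set $A$ such that, with $g_{j,A}=g_j\mathbf 1_{\{Z\in A\}}$ and $g_{-j,A}$ the vector obtained by stacking the $g_{l,A}$, $l\neq j$: all $g_{j,A}$ are essentially bounded; for each $j$ the matrix $E[g_{-j,A}g_{-j,A}'\mid X]$ is a.s. invertible with essentially bounded inverse; and for each $j$ so is $E[b_jb_j'\mid X^{(j)}]$, where $b_j=g_{j,A}-E[g_{j,A}g_{-j,A}'\mid X]\,E[g_{-j,A}g_{-j,A}'\mid X]^{-1}g_{-j,A}$. **Assumption SP.** (1) There is a family of laws $\theta\mapsto P_{\theta,\eta_0}$, defined for $\theta$ near $\theta_0$, with $P_{\theta_0,\eta_0}=P_0$, such that $\theta_0+u\mapsto(\theta_0+u,P_{\theta_0+u,\eta_0})$ is a $d$-dimensional regular submodel of $\mathcal P$ and of every $\mathcal P_k$, $k\ge1$. (2) For every $k\ge1$ the matrix $$I^{(k)}_{\theta_0}=E[\partial_{\theta'}g_k^w(Z,\theta_0)]'\;V^-[g_k^w(Z,\theta_0)]\;E[\partial_{\theta'}g_k^w(Z,\theta_0)]$$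 is nonsingular, where $E[\partial_{\theta'}g_k^w(Z,\theta_0)]$ is the derivative of $\theta\mapsto E[g_k^w(Z,\theta)]$ at $\theta_0$ (it exists under the other assumptions) and $V^-$ is any generalized inverse of the variance matrix $V$, i.e. $VV^-V=V$. **Theorem.** Under Assumptions T and SP, the maps $\theta\mapsto E[g_k^w(Z,\theta)]$ are differentiable at $\theta_0$; for every $k\ge1$ the information on $\theta_0$ at $P_0$ in the model $\mathcal P_k$ exists and equals $I^{(k)}_{\theta_0}$; the information $I_{\theta_0}$ on $\theta_0$ at $P_0$ in the model $\mathcal P$ exists; and $$I_{\theta_0}=\lim_{k\to\infty}I^{(k)}_{\theta_0}.$$ -/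

import Mathlib

open MeasureTheory Filter Topology
open scoped ENNReal NNReal

namespace CondMoment

variable {q d J : ℕ} {p : Fin J → ℕ} {ι κ : Type*}

/-! ### Regular submodels, tangent spaces and the information bound

The sample space is `Fin q → ℝ`, a parameter value is a vector `Fin d → ℝ`, and a statistical
model is a set of pairs `(θ, P)`: the law `P` belongs to the model, with parameter value `θ`. -/

/-- The square root of the density of `P` with respect to the dominating measure `μ`. -/
noncomputable def sqrtDensity (μ P : Measure (Fin q → ℝ)) (z : Fin q → ℝ) : ℝ :=
  Real.sqrt (P.rnDeriv μ z).toReal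

/-- A regular parametric submodel `u ↦ (ϑ u, P u)`, with `u` near `0` in a normed space `E`, of a
model `M` given by the moment functions `m`. It passes through `(θ₀, P₀)` at `u = 0`; the parameter
is differentiable with derivative `D`; the laws are differentiable in quadratic mean, with score
`S u` in the direction `u`; along the submodel the moment functions have bounded second moments,
and they are mean-square continuous under `P₀`. -/
structure IsRegularSubmodel {E : Type*} [NormedAddCommGroup E] [NormedSpace ℝ E]
    (μ P₀ : Measure (Fin q → ℝ)) (θ₀ : Fin d → ℝ)
    (M : Set ((Fin d → ℝ) × Measure (Fin q → ℝ)))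
    (m : ι → (Fin q → ℝ) → (Fin d → ℝ) → ℝ)
    (ϑ : E → Fin d → ℝ) (P : E → Measure (Fin q → ℝ))
    (D : E →L[ℝ] (Fin d → ℝ)) (S : E →L[ℝ] Lp ℝ 2 P₀) : Prop where
  theta_zero : ϑ 0 = θ₀
  law_zero : P 0 = P₀
  mem : ∀ᶠ u in 𝓝 0, (ϑ u, P u) ∈ M
  hasFDerivAt : HasFDerivAt ϑ D 0
  dqm : ∀ ε : ℝ, 0 < ε → ∀ᶠ u in 𝓝 0,
    eLpNorm (fun z => sqrtDensity μ (P u) z - sqrtDensity μ P₀ z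
      - (1 / 2 : ℝ) * (S u) z * sqrtDensity μ P₀ z) 2 μ ≤ ENNReal.ofReal (ε * ‖u‖)
  moment_bounded : ∀ i, ∃ C : ℝ≥0, ∀ᶠ u in 𝓝 0,
    eLpNorm (fun z => m i z (ϑ u)) 2 (P u) ≤ C
  moment_continuous : ∀ i,
    Tendsto (fun u => eLpNorm (fun z => m i z (ϑ u) - m i z θ₀) 2 P₀) (𝓝 0) (𝓝 0)

/-- `s` is the score and `v` the derivative of the parameter at `0`, for some regular
one-dimensional submodel. -/
def IsTangent (μ P₀ : Measure (Fin q → ℝ)) (θ₀ : Fin d → ℝ)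
    (M : Set ((Fin d → ℝ) × Measure (Fin q → ℝ)))
    (m : ι → (Fin q → ℝ) → (Fin d → ℝ) → ℝ) (v : Fin d → ℝ) (s : Lp ℝ 2 P₀) : Prop :=
  ∃ (ϑ : ℝ → Fin d → ℝ) (P : ℝ → Measure (Fin q → ℝ))
    (D : ℝ →L[ℝ] (Fin d → ℝ)) (S : ℝ →L[ℝ] Lp ℝ 2 P₀),
    IsRegularSubmodel μ P₀ θ₀ M m ϑ P D S ∧ D 1 = v ∧ S 1 = s

/-- The tangent set: all scores of regular one-dimensional submodels. -/
def tangentSet (μ P₀ : Measure (Fin q → ℝ)) (θ₀ : Fin d → ℝ)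
    (M : Set ((Fin d → ℝ) × Measure (Fin q → ℝ)))
    (m : ι → (Fin q → ℝ) → (Fin d → ℝ) → ℝ) : Set (Lp ℝ 2 P₀) :=
  {s | ∃ v, IsTangent μ P₀ θ₀ M m v s}

/-- The tangent space: the closed linear span of the tangent set. -/
noncomputable def tangentSpace (μ P₀ : Measure (Fin q → ℝ)) (θ₀ : Fin d → ℝ)
    (M : Set ((Fin d → ℝ) × Measure (Fin q → ℝ)))
    (m : ι → (Fin q → ℝ) → (Fin d → ℝ) → ℝ) : Submodule ℝ (Lp ℝ 2 P₀) :=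
  (Submodule.span ℝ (tangentSet μ P₀ θ₀ M m)).topologicalClosure

/-- The efficient influence function of the parameter: its components lie in the tangent space and
represent the derivative of the parameter along every regular one-dimensional submodel. -/
structure IsEfficientInfluence (μ P₀ : Measure (Fin q → ℝ)) (θ₀ : Fin d → ℝ)
    (M : Set ((Fin d → ℝ) × Measure (Fin q → ℝ)))
    (m : ι → (Fin q → ℝ) → (Fin d → ℝ) → ℝ) (ψ : Fin d → Lp ℝ 2 P₀) : Prop where
  mem : ∀ l, ψ l ∈ tangentSpace μ P₀ θ₀ M m
  deriv : ∀ v s, IsTangent μ P₀ θ₀ M m v s → ∀ l, inner ℝ (ψ l) s = v l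

/-- `I` is the information on the parameter at `(θ₀, P₀)` in the model: the efficient influence
function exists, its variance matrix is nonsingular, and `I` is the inverse of that matrix. -/
def IsInformation (μ P₀ : Measure (Fin q → ℝ)) (θ₀ : Fin d → ℝ)
    (M : Set ((Fin d → ℝ) × Measure (Fin q → ℝ)))
    (m : ι → (Fin q → ℝ) → (Fin d → ℝ) → ℝ) (I : Matrix (Fin d) (Fin d) ℝ) : Prop :=
  ∃ ψ : Fin d → Lp ℝ 2 P₀, IsEfficientInfluence μ P₀ θ₀ M m ψ ∧
    IsUnit (Matrix.gram ℝ ψ).det ∧ I = (Matrix.gram ℝ ψ)⁻¹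

/-- The efficient influence function, hence the information, is unique. -/
theorem IsInformation.unique {μ P₀ : Measure (Fin q → ℝ)} {θ₀ : Fin d → ℝ}
    {M : Set ((Fin d → ℝ) × Measure (Fin q → ℝ))}
    {m : ι → (Fin q → ℝ) → (Fin d → ℝ) → ℝ} {I I' : Matrix (Fin d) (Fin d) ℝ}
    (h : IsInformation μ P₀ θ₀ M m I) (h' : IsInformation μ P₀ θ₀ M m I') : I = I' := by
  obtain ⟨ψ, hψ, -, rfl⟩ := h
  obtain ⟨φ, hφ, -, rfl⟩ := h'
  have key : ψ = φ := by
    funext l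
    have hmem : ψ l - φ l ∈ tangentSpace μ P₀ θ₀ M m := Submodule.sub_mem _ (hψ.mem l) (hφ.mem l)
    have horth : ψ l - φ l ∈ (tangentSpace μ P₀ θ₀ M m)ᗮ := by
      rw [tangentSpace, Submodule.orthogonal_closure, Submodule.mem_orthogonal']
      intro s hs
      induction hs using Submodule.span_induction with
      | mem s hs =>
        obtain ⟨v, hv⟩ := hs
        rw [inner_sub_left, hψ.deriv v s hv l, hφ.deriv v s hv l, sub_self]
      | zero => exact inner_zero_right _
      | add x y _ _ hx hy => rw [inner_add_right, hx, hy, add_zero]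
      | smul c x _ hx => rw [inner_smul_right, hx, mul_zero]
    have h0 : inner ℝ (ψ l - φ l) (ψ l - φ l) = 0 :=
      (Submodule.mem_orthogonal _ _).1 horth _ hmem
    exact sub_eq_zero.1 (inner_self_eq_zero.1 h0)
  rw [key]

/-! ### The moment models -/

/-- The σ-algebra generated by the subvector of the coordinates in `s`. -/
abbrev coordSigma (s : Finset (Fin q)) : MeasurableSpace (Fin q → ℝ) :=
  MeasurableSpace.comap (fun (z : Fin q → ℝ) (i : s) => z i) inferInstance

/-- The components of `(g₁, …, g_J)`, as one family. -/
def stacked (g : (j : Fin J) → (Fin q → ℝ) → (Fin d → ℝ) → Fin (p j) → ℝ)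
    (a : (j : Fin J) × Fin (p j)) (z : Fin q → ℝ) (θ : Fin d → ℝ) : ℝ :=
  g a.1 z θ a.2

/-- The model `E[g_j(Z, θ) | X⁽ʲ⁾] = 0`, `j = 1, …, J`, where `X⁽ʲ⁾` consists of the coordinates of
`Z` in `X j`. -/
def conditionalModel (μ : Measure (Fin q → ℝ)) (Θ : Set (Fin d → ℝ)) (X : Fin J → Finset (Fin q))
    (g : (j : Fin J) → (Fin q → ℝ) → (Fin d → ℝ) → Fin (p j) → ℝ) :
    Set ((Fin d → ℝ) × Measure (Fin q → ℝ)) :=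
  {x | x.1 ∈ Θ ∧ IsProbabilityMeasure x.2 ∧ x.2 ≪ μ ∧
    ∀ j i, Integrable (fun z => g j z x.1 i) x.2 ∧
      x.2[fun z => g j z x.1 i | coordSigma (X j)] =ᵐ[x.2] 0}

/-- The model given by the unconditional moment equations `E[m_i(Z, θ)] = 0`. -/
def unconditionalModel (μ : Measure (Fin q → ℝ)) (Θ : Set (Fin d → ℝ))
    (m : ι → (Fin q → ℝ) → (Fin d → ℝ) → ℝ) :
    Set ((Fin d → ℝ) × Measure (Fin q → ℝ)) :=
  {x | x.1 ∈ Θ ∧ IsProbabilityMeasure x.2 ∧ x.2 ≪ μ ∧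
    ∀ i, Integrable (fun z => m i z x.1) x.2 ∧ ∫ z, m i z x.1 ∂x.2 = 0}

/-- The components `E[w_s(Z) | X⁽ʲ⁾] g_{j,i}(Z, θ)`, `s < k`, of the moment vector with `k`
instruments; the conditional expectation is under `P₀`. -/
noncomputable def instrumented (P₀ : Measure (Fin q → ℝ)) (X : Fin J → Finset (Fin q))
    (g : (j : Fin J) → (Fin q → ℝ) → (Fin d → ℝ) → Fin (p j) → ℝ)
    (w : ℕ → (Fin q → ℝ) → ℝ) (k : ℕ)
    (a : Fin k × ((j : Fin J) × Fin (p j))) (z : Fin q → ℝ) (θ : Fin d → ℝ) : ℝ :=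
  (P₀[w a.1 | coordSigma (X a.2.1)]) z * stacked g a.2 z θ

/-- The matrix `E[∂_{θ'} m(Z, θ₀)]`, i.e. the derivative of `θ ↦ E[m(Z, θ)]` at `θ₀`. -/
noncomputable def jacobian (P₀ : Measure (Fin q → ℝ)) (θ₀ : Fin d → ℝ)
    (m : ι → (Fin q → ℝ) → (Fin d → ℝ) → ℝ) : Matrix ι (Fin d) ℝ :=
  Matrix.of fun a l => fderiv ℝ (fun θ => ∫ z, m a z θ ∂P₀) θ₀ (Pi.single l 1)

/-- The variance matrix of `m(Z, θ₀)`. -/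
noncomputable def momentVariance (P₀ : Measure (Fin q → ℝ)) (θ₀ : Fin d → ℝ)
    (m : ι → (Fin q → ℝ) → (Fin d → ℝ) → ℝ) : Matrix ι ι ℝ :=
  Matrix.of fun a b =>
    ProbabilityTheory.covariance (fun z => m a z θ₀) (fun z => m b z θ₀) P₀

/-- `G` is a generalized inverse of `V`. -/
def IsGeneralizedInverse [Fintype ι] (V G : Matrix ι ι ℝ) : Prop :=
  V * G * V = V

/-- The matrix `E[∂_{θ'} m]' V⁻ E[∂_{θ'} m]`, with `G` in the place of `V⁻`. -/
noncomputable def momentInformation [Fintype ι] (P₀ : Measure (Fin q → ℝ)) (θ₀ : Fin d → ℝ)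
    (m : ι → (Fin q → ℝ) → (Fin d → ℝ) → ℝ) (G : Matrix ι ι ℝ) : Matrix (Fin d) (Fin d) ℝ :=
  (jacobian P₀ θ₀ m).transpose * G * jacobian P₀ θ₀ m

/-! ### Assumption T -/

/-- The matrix `E[f h' | 𝓖]`. -/
noncomputable def condMatrix (P₀ : Measure (Fin q → ℝ)) (𝓖 : MeasurableSpace (Fin q → ℝ))
    (f : ι → (Fin q → ℝ) → ℝ) (h : κ → (Fin q → ℝ) → ℝ) (z : Fin q → ℝ) : Matrix ι κ ℝ :=
  Matrix.of fun a b => (P₀[fun y => f a y * h b y | 𝓖]) z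

/-- `E[f f' | 𝓖]` is almost surely invertible, with an essentially bounded inverse. -/
def HasBoundedInverse [Fintype ι] [DecidableEq ι] (P₀ : Measure (Fin q → ℝ))
    (𝓖 : MeasurableSpace (Fin q → ℝ)) (f : ι → (Fin q → ℝ) → ℝ) : Prop :=
  ∃ C : ℝ, ∀ᵐ z ∂P₀, IsUnit (condMatrix P₀ 𝓖 f f z).det ∧
    ∀ a b, |(condMatrix P₀ 𝓖 f f z)⁻¹ a b| ≤ C

/-- The components of `g_{j,A} = g_j(Z, θ₀) 1_A(Z)`. -/
noncomputable def truncated (θ₀ : Fin d → ℝ)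
    (g : (j : Fin J) → (Fin q → ℝ) → (Fin d → ℝ) → Fin (p j) → ℝ) (A : Set (Fin q → ℝ))
    (j : Fin J) (i : Fin (p j)) : (Fin q → ℝ) → ℝ :=
  A.indicator fun z => g j z θ₀ i

/-- The vector `g_{-j,A}` obtained by stacking the `g_{l,A}` with `l ≠ j`. -/
noncomputable def truncatedOthers (θ₀ : Fin d → ℝ)
    (g : (j : Fin J) → (Fin q → ℝ) → (Fin d → ℝ) → Fin (p j) → ℝ) (A : Set (Fin q → ℝ))
    (j : Fin J) (a : {a : (l : Fin J) × Fin (p l) // a.1 ≠ j}) : (Fin q → ℝ) → ℝ :=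
  truncated θ₀ g A a.1.1 a.1.2

/-- All coordinates that occur in one of the conditioning vectors. -/
def allCoords (X : Fin J → Finset (Fin q)) : Finset (Fin q) :=
  Finset.univ.biUnion X

/-- `b_j = g_{j,A} - E[g_{j,A} g_{-j,A}' | X] E[g_{-j,A} g_{-j,A}' | X]⁻¹ g_{-j,A}`, where `X` is the
vector of all coordinates that occur in one of the conditioning vectors. -/
noncomputable def residual (P₀ : Measure (Fin q → ℝ)) (θ₀ : Fin d → ℝ)
    (X : Fin J → Finset (Fin q))
    (g : (j : Fin J) → (Fin q → ℝ) → (Fin d → ℝ) → Fin (p j) → ℝ) (A : Set (Fin q → ℝ))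
    (j : Fin J) (i : Fin (p j)) (z : Fin q → ℝ) : ℝ :=
  truncated θ₀ g A j i z -
    ((condMatrix P₀ (coordSigma (allCoords X)) (truncated θ₀ g A j) (truncatedOthers θ₀ g A j) z *
      (condMatrix P₀ (coordSigma (allCoords X)) (truncatedOthers θ₀ g A j)
        (truncatedOthers θ₀ g A j) z)⁻¹).mulVec
      fun a => truncatedOthers θ₀ g A j a z) i

/-- Assumption T, for an arbitrary number `J` of conditional restrictions. -/
def AssumptionT (P₀ : Measure (Fin q → ℝ)) (θ₀ : Fin d → ℝ) (X : Fin J → Finset (Fin q))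
    (g : (j : Fin J) → (Fin q → ℝ) → (Fin d → ℝ) → Fin (p j) → ℝ) : Prop :=
  ∃ A : Set (Fin q → ℝ), MeasurableSet A ∧
    (∃ C : ℝ, ∀ j i, ∀ᵐ z ∂P₀, |truncated θ₀ g A j i z| ≤ C) ∧
    (∀ j, HasBoundedInverse P₀ (coordSigma (allCoords X)) (truncatedOthers θ₀ g A j)) ∧
    (∀ j, HasBoundedInverse P₀ (coordSigma (X j)) (residual P₀ θ₀ X g A j))

/-! ### Assumption SP -/

/-- The semiparametric structure. `Q θ` stands for `P_{θ,η₀}` in the representation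
`{P_{θ,η} : θ ∈ Θ, η ∈ H}`, `{P_{θ,η} : θ ∈ Θ, η ∈ H_k}` of the models, with `η₀ ∈ H ⊆ H_k`: the
family `θ ↦ P_{θ,η₀}` is a regular submodel of all the models, with the same score for `θ` at
`θ₀`. -/
def AssumptionSP (μ P₀ : Measure (Fin q → ℝ)) (Θ : Set (Fin d → ℝ)) (θ₀ : Fin d → ℝ)
    (X : Fin J → Finset (Fin q))
    (g : (j : Fin J) → (Fin q → ℝ) → (Fin d → ℝ) → Fin (p j) → ℝ)
    (w : ℕ → (Fin q → ℝ) → ℝ) : Prop :=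
  ∃ (Q : (Fin d → ℝ) → Measure (Fin q → ℝ)) (S : (Fin d → ℝ) →L[ℝ] Lp ℝ 2 P₀),
    IsRegularSubmodel μ P₀ θ₀ (conditionalModel μ Θ X g) (stacked g)
      (fun u => θ₀ + u) (fun u => Q (θ₀ + u)) (ContinuousLinearMap.id ℝ (Fin d → ℝ)) S ∧
    ∀ k, 1 ≤ k → IsRegularSubmodel μ P₀ θ₀
      (unconditionalModel μ Θ (instrumented P₀ X g w k)) (instrumented P₀ X g w k)
      (fun u => θ₀ + u) (fun u => Q (θ₀ + u)) (ContinuousLinearMap.id ℝ (Fin d → ℝ)) S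

end CondMoment

/-!
The proof is a projection argument in the Hilbert space `L²(P₀)`.

*Scores.* Write `S v` for the score, in the direction `v`, of the submodel of Assumption SP that is
parametrized by `θ`. Expanding the identity `E_u[m(Z, θ_u)] = 0` along a regular submodel with the
help of root densities (`DQM.hasFDerivAt_integral`) gives
`d E₀[m(Z, θ_u)] = -E₀[m(Z, θ₀) s]`, where `s` is the score. Applied to the submodel of Assumption
SP this shows that `θ ↦ E₀[m(Z, θ)]` is differentiable, and by comparison that the score of any
submodel in which `θ` moves in the direction `v` is `S v + h`, with `h` of mean zero and orthogonal
to the moment functions (`inner_moment_score_sub`). In the conditional model the same holds with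
the moment functions `1_B g_j`, for `B` in the σ-algebra of `X⁽ʲ⁾`; there `h` is orthogonal to `g_j`
conditionally on `X⁽ʲ⁾` (`isNuisance_score_sub`). Conversely, a bounded `h` with these properties is
the score of the path `(1 + t h) P₀` with `θ` fixed (`isTangent_of_bounded`).

*Density.* If such bounded `h` are dense among all such `h`, and `K` is the orthogonal complement of
the set of all these `h`, then the tangent space is the sum of `Kᗮ` and the range of `S`. So the
projection of the score for `θ` to `K` is the efficient score, and its Gram matrix, once
nonsingular, is the information (`isInformation_gram_starProjection`). With `k` instruments the
space `K` is spanned by the constants and finitely many moment functions, and density follows by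
duality (`orthogonal_span_le_closure_inf`). In the conditional model, density is the place where
Assumption T enters: it provides a bounded family that is biorthogonal to the moment functions in
the conditional sense (`AssumptionT.exists_isBiorthogonal`), which is used to restore the
conditional restrictions for a bounded approximation of `h`, at a small cost in `L²(P₀)`
(`IsNuisance.mem_closure`).

*Limit.* Let `K_k` and `K_∞` be the spaces `K` of the model with `k` instruments and of the
conditional model. The `K_k` increase, and since the instruments are dense in `L²(P₀)` and the
conditional variances are bounded, the closure of their union is `K_∞` (`isNuisance_iff`). Hence the
projections to `K_k` converge strongly to the projection to `K_∞`, and so the Gram matrices of the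
projected scores converge. By linear algebra the Gram matrix for `K_k` is the information matrix
`E[∂m]' V⁻ E[∂m]` of its moment functions `m` (`momentInformation_eq_gram`), and the limit is
nonsingular because it dominates the matrix for `k = 1`.
-/

namespace CondMoment

/-! ### Square roots of densities -/

section SqrtDensity

variable {q : ℕ} {μ P P₀ : Measure (Fin q → ℝ)}

/-- The Cauchy–Schwarz inequality for functions. -/
theorem abs_integral_mul_le {α : Type*} [MeasurableSpace α] {ν : Measure α} {f h : α → ℝ}
    (hf : MemLp f 2 ν) (hh : MemLp h 2 ν) :
    |∫ x, f x * h x ∂ν| ≤ (eLpNorm f 2 ν).toReal * (eLpNorm h 2 ν).toReal := by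
  have h1 : ∫ x, f x * h x ∂ν = inner ℝ (hh.toLp h) (hf.toLp f) := by
    rw [L2.inner_def]
    apply integral_congr_ae
    filter_upwards [hf.coeFn_toLp, hh.coeFn_toLp] with x h1 h2
    simp [h1, h2]
  rw [h1, mul_comm]
  have := abs_real_inner_le_norm (hh.toLp h) (hf.toLp f)
  rwa [Lp.norm_toLp, Lp.norm_toLp] at this

theorem measurable_sqrtDensity : Measurable (sqrtDensity μ P) :=
  (Measure.measurable_rnDeriv P μ).ennreal_toReal.sqrt

theorem sqrtDensity_mul_self (z : Fin q → ℝ) :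
    sqrtDensity μ P z * sqrtDensity μ P z = (P.rnDeriv μ z).toReal :=
  Real.mul_self_sqrt ENNReal.toReal_nonneg

/-- Functions that agree `P`-almost surely agree `μ`-almost everywhere once multiplied by the root
density of `P`. -/
theorem mul_sqrtDensity_congr [SigmaFinite μ] [IsFiniteMeasure P] (hP : P ≪ μ)
    {f h : (Fin q → ℝ) → ℝ} (hfh : f =ᵐ[P] h) :
    (fun z => f z * sqrtDensity μ P z) =ᵐ[μ] fun z => h z * sqrtDensity μ P z := by
  have : P = μ.withDensity (P.rnDeriv μ) := (Measure.withDensity_rnDeriv_eq P μ hP).symm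
  rw [Filter.EventuallyEq, this, ae_withDensity_iff (Measure.measurable_rnDeriv P μ)] at hfh
  filter_upwards [hfh] with z hz
  by_cases h0 : P.rnDeriv μ z = 0
  · simp [sqrtDensity, h0]
  · rw [hz h0]

theorem eLpNorm_mul_sqrtDensity [SigmaFinite μ] [IsFiniteMeasure P] (hP : P ≪ μ)
    {f : (Fin q → ℝ) → ℝ} (hf : AEStronglyMeasurable f P) :
    eLpNorm (fun z => f z * sqrtDensity μ P z) 2 μ = eLpNorm f 2 P := by
  -- replacing `f` by a measurable version changes both sides only on null sets
  obtain ⟨f', hf'm, hff'⟩ := hf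
  have hff'μ := mul_sqrtDensity_congr hP hff'
  rw [eLpNorm_congr_ae hff'μ, eLpNorm_congr_ae hff']
  rw [eLpNorm_eq_lintegral_rpow_enorm_toReal (by norm_num) (by norm_num),
    eLpNorm_eq_lintegral_rpow_enorm_toReal (by norm_num) (by norm_num)]
  congr 1
  rw [← lintegral_rnDeriv_mul hP (by fun_prop)]
  apply lintegral_congr_ae
  filter_upwards [Measure.rnDeriv_lt_top P μ] with z hz
  have : ‖sqrtDensity μ P z‖ₑ ^ (2 : ℝ) = P.rnDeriv μ z := by
    have h0 : 0 ≤ sqrtDensity μ P z := Real.sqrt_nonneg _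
    rw [Real.enorm_eq_ofReal h0, ENNReal.ofReal_rpow_of_nonneg h0 (by norm_num), Real.rpow_two,
      pow_two, sqrtDensity_mul_self, ENNReal.ofReal_toReal hz.ne]
  simp only [ENNReal.toReal_ofNat, enorm_mul]
  rw [ENNReal.mul_rpow_of_nonneg _ _ (by norm_num), this, mul_comm]

theorem aestronglyMeasurable_mul_sqrtDensity [SigmaFinite μ] [IsFiniteMeasure P] (hP : P ≪ μ)
    {f : (Fin q → ℝ) → ℝ} (hf : AEStronglyMeasurable f P) :
    AEStronglyMeasurable (fun z => f z * sqrtDensity μ P z) μ := by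
  obtain ⟨f', hf'm, hff'⟩ := hf
  have hff'μ := mul_sqrtDensity_congr hP hff'
  exact (hf'm.mul measurable_sqrtDensity.stronglyMeasurable).aestronglyMeasurable.congr hff'μ.symm

theorem memLp_mul_sqrtDensity [SigmaFinite μ] [IsFiniteMeasure P] (hP : P ≪ μ)
    {f : (Fin q → ℝ) → ℝ} (hf : MemLp f 2 P) :
    MemLp (fun z => f z * sqrtDensity μ P z) 2 μ :=
  ⟨aestronglyMeasurable_mul_sqrtDensity hP hf.1, by
    rw [eLpNorm_mul_sqrtDensity hP hf.1]; exact hf.2⟩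

theorem integral_mul_sqrtDensity [SigmaFinite μ] [IsFiniteMeasure P] (hP : P ≪ μ)
    (f : (Fin q → ℝ) → ℝ) :
    ∫ z, f z * sqrtDensity μ P z * sqrtDensity μ P z ∂μ = ∫ z, f z ∂P := by
  rw [← integral_rnDeriv_smul hP]
  congr 1
  funext z
  rw [mul_assoc, sqrtDensity_mul_self, smul_eq_mul, mul_comm]

theorem memLp_sqrtDensity [SigmaFinite μ] [IsFiniteMeasure P] (hP : P ≪ μ) :
    MemLp (sqrtDensity μ P) 2 μ := by
  simpa using memLp_mul_sqrtDensity hP (memLp_const (1 : ℝ))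

theorem toReal_eLpNorm_sub_le {α : Type*} [MeasurableSpace α] {ν : Measure α}
    {f h : α → ℝ} (hf : MemLp f 2 ν) (hh : MemLp h 2 ν) :
    (eLpNorm (fun x => f x - h x) 2 ν).toReal
      ≤ (eLpNorm f 2 ν).toReal + (eLpNorm h 2 ν).toReal := by
  rw [← ENNReal.toReal_add hf.2.ne hh.2.ne]
  exact ENNReal.toReal_mono (ENNReal.add_ne_top.2 ⟨hf.2.ne, hh.2.ne⟩)
    (eLpNorm_sub_le hf.1 hh.1 (by norm_num))

theorem toReal_eLpNorm_add_le {α : Type*} [MeasurableSpace α] {ν : Measure α}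
    {f h : α → ℝ} (hf : MemLp f 2 ν) (hh : MemLp h 2 ν) :
    (eLpNorm (fun x => f x + h x) 2 ν).toReal
      ≤ (eLpNorm f 2 ν).toReal + (eLpNorm h 2 ν).toReal := by
  rw [← ENNReal.toReal_add hf.2.ne hh.2.ne]
  exact ENNReal.toReal_mono (ENNReal.add_ne_top.2 ⟨hf.2.ne, hh.2.ne⟩)
    (eLpNorm_add_le hf.1 hh.1 (by norm_num))

end SqrtDensity

/-! ### Differentiating moments along a path that is differentiable in quadratic mean -/

section Differentiation

variable {q : ℕ} {μ P₀ : Measure (Fin q → ℝ)} {E : Type*} [NormedAddCommGroup E]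
  [NormedSpace ℝ E]

/-- Differentiability in quadratic mean of `u ↦ P u` at `0`, with score `S`. -/
def DQM (μ P₀ : Measure (Fin q → ℝ)) (P : E → Measure (Fin q → ℝ))
    (S : E →L[ℝ] Lp ℝ 2 P₀) : Prop :=
  ∀ ε : ℝ, 0 < ε → ∀ᶠ u in 𝓝 0,
    eLpNorm (fun z => sqrtDensity μ (P u) z - sqrtDensity μ P₀ z
      - (1 / 2 : ℝ) * (S u) z * sqrtDensity μ P₀ z) 2 μ ≤ ENNReal.ofReal (ε * ‖u‖)

variable {P : E → Measure (Fin q → ℝ)} {S : E →L[ℝ] Lp ℝ 2 P₀}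

theorem memLp_score_mul_sqrtDensity [SigmaFinite μ] [IsFiniteMeasure P₀] (hP₀ : P₀ ≪ μ)
    (s : Lp ℝ 2 P₀) : MemLp (fun z => s z * sqrtDensity μ P₀ z) 2 μ :=
  memLp_mul_sqrtDensity hP₀ (Lp.memLp s)

theorem toReal_eLpNorm_score_mul_sqrtDensity [SigmaFinite μ] [IsFiniteMeasure P₀] (hP₀ : P₀ ≪ μ)
    (s : Lp ℝ 2 P₀) : (eLpNorm (fun z => s z * sqrtDensity μ P₀ z) 2 μ).toReal = ‖s‖ := by
  rw [eLpNorm_mul_sqrtDensity hP₀ (Lp.memLp s).1, Lp.norm_def]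

theorem memLp_remainder [SigmaFinite μ] [IsFiniteMeasure P₀] (hP₀ : P₀ ≪ μ)
    {Q : Measure (Fin q → ℝ)} [IsFiniteMeasure Q] (hQ : Q ≪ μ) (s : Lp ℝ 2 P₀) :
    MemLp (fun z => sqrtDensity μ Q z - sqrtDensity μ P₀ z
      - (1 / 2 : ℝ) * s z * sqrtDensity μ P₀ z) 2 μ := by
  have := ((memLp_sqrtDensity hQ).sub (memLp_sqrtDensity hP₀)).sub
    ((memLp_score_mul_sqrtDensity hP₀ s).const_mul (1 / 2))
  refine this.ae_eq (Eventually.of_forall fun z => ?_)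
  simp only [Pi.sub_apply]
  ring

/-- Differentiability in quadratic mean implies continuity in Hellinger distance. -/
theorem DQM.tendsto_sqrtDensity [SigmaFinite μ] [IsFiniteMeasure P₀] (hP₀ : P₀ ≪ μ)
    (hP : ∀ᶠ u in 𝓝 0, IsProbabilityMeasure (P u) ∧ P u ≪ μ) (h : DQM μ P₀ P S) :
    Tendsto (fun u => (eLpNorm (fun z => sqrtDensity μ (P u) z - sqrtDensity μ P₀ z) 2 μ).toReal)
      (𝓝 0) (𝓝 0) := by
  have hlim : Tendsto (fun u : E => ‖u‖ + 1 / 2 * ‖S u‖) (𝓝 0) (𝓝 0) := by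
    have : Continuous fun u : E => ‖u‖ + 1 / 2 * ‖S u‖ := by fun_prop
    simpa using this.tendsto 0
  refine squeeze_zero' (Eventually.of_forall fun _ => ENNReal.toReal_nonneg) ?_ hlim
  filter_upwards [hP, h 1 one_pos] with u hu hr
  have := hu.1
  have hS := (memLp_score_mul_sqrtDensity hP₀ (S u)).const_mul (1 / 2)
  have h1 := toReal_eLpNorm_add_le (memLp_remainder hP₀ hu.2 (S u)) hS
  have h2 : (eLpNorm (fun z => 1 / 2 * ((S u) z * sqrtDensity μ P₀ z)) 2 μ).toReal
      = 1 / 2 * ‖S u‖ := by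
    have := eLpNorm_const_smul (1 / 2 : ℝ) (fun z => (S u) z * sqrtDensity μ P₀ z) 2 μ
    simp only [Pi.smul_def, smul_eq_mul] at this
    rw [this, ENNReal.toReal_mul, toReal_eLpNorm_score_mul_sqrtDensity hP₀]
    simp
  have h3 := ENNReal.toReal_mono ENNReal.ofReal_ne_top hr
  rw [one_mul, ENNReal.toReal_ofReal (norm_nonneg _)] at h3
  rw [h2] at h1
  refine le_trans (le_of_eq ?_) (h1.trans (add_le_add_left h3 _))
  congr 2
  funext z
  ring

/-- The root densities converge strongly, while `m_u √p_u` and `m_u √p₀` stay bounded in `L²(μ)`,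
so that their difference tends to `0` weakly, tested against the functions `s √p₀`. -/
theorem DQM.tendsto_integral_cross [SigmaFinite μ] [IsFiniteMeasure P₀] (hP₀ : P₀ ≪ μ)
    (hP : ∀ᶠ u in 𝓝 0, IsProbabilityMeasure (P u) ∧ P u ≪ μ) (h : DQM μ P₀ P S)
    {m : E → (Fin q → ℝ) → ℝ} {C : ℝ}
    (hC : ∀ᶠ u in 𝓝 0, MemLp (m u) 2 (P u) ∧ (eLpNorm (m u) 2 (P u)).toReal ≤ C)
    (hC₀ : ∀ᶠ u in 𝓝 0, MemLp (m u) 2 P₀ ∧ (eLpNorm (m u) 2 P₀).toReal ≤ C) (s : Lp ℝ 2 P₀) :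
    Tendsto (fun u => ∫ z, (m u z * sqrtDensity μ (P u) z - m u z * sqrtDensity μ P₀ z)
      * (s z * sqrtDensity μ P₀ z) ∂μ) (𝓝 0) (𝓝 0) := by
  rw [Metric.tendsto_nhds]
  intro ε hε
  obtain ⟨C, hC0, hC, hC₀⟩ : ∃ C, 0 < C ∧
      (∀ᶠ u in 𝓝 0, MemLp (m u) 2 (P u) ∧ (eLpNorm (m u) 2 (P u)).toReal ≤ C) ∧
      (∀ᶠ u in 𝓝 0, MemLp (m u) 2 P₀ ∧ (eLpNorm (m u) 2 P₀).toReal ≤ C) :=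
    ⟨max C 1, by positivity, hC.mono fun u hu => ⟨hu.1, hu.2.trans (le_max_left _ _)⟩,
      hC₀.mono fun u hu => ⟨hu.1, hu.2.trans (le_max_left _ _)⟩⟩
  obtain ⟨f, hf, hfm⟩ := (Lp.memLp s).exists_simpleFunc_eLpNorm_sub_lt (by norm_num)
    (ε := ENNReal.ofReal (ε / (8 * C))) (by
      rw [ne_eq, ENNReal.ofReal_eq_zero, not_le]; positivity)
  obtain ⟨K, hK0, hK⟩ : ∃ K : ℝ, 0 < K ∧ ∀ z, ‖f z‖ ≤ K := by
    obtain ⟨K, hK⟩ := f.exists_forall_norm_le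
    exact ⟨max K 1, by positivity, fun z => (hK z).trans (le_max_left _ _)⟩
  have hlim := (h.tendsto_sqrtDensity hP₀ hP).eventually_lt_const
    (show (0 : ℝ) < ε / (4 * C * K) by positivity)
  filter_upwards [hP, hC, hC₀, hlim] with u hu hCu hC₀u hd
  have := hu.1
  have ha := memLp_mul_sqrtDensity hu.2 hCu.1
  have hb := memLp_mul_sqrtDensity hP₀ hC₀u.1
  have hab := ha.sub hb
  have hsf := memLp_mul_sqrtDensity hP₀ ((Lp.memLp s).sub hfm)
  -- the contribution of the tail `s - f` of the test function
  have e1 := abs_integral_mul_le hab hsf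
  have e1' : (eLpNorm ((fun z => m u z * sqrtDensity μ (P u) z) -
      fun z => m u z * sqrtDensity μ P₀ z) 2 μ).toReal ≤ C + C := by
    refine (toReal_eLpNorm_sub_le ha hb).trans ?_
    rw [eLpNorm_mul_sqrtDensity hu.2 hCu.1.1, eLpNorm_mul_sqrtDensity hP₀ hC₀u.1.1]
    exact add_le_add hCu.2 hC₀u.2
  have e1'' : (eLpNorm (fun z => ((s : (Fin q → ℝ) → ℝ) - f) z * sqrtDensity μ P₀ z) 2 μ).toReal
      ≤ ε / (8 * C) := by
    rw [eLpNorm_mul_sqrtDensity hP₀ ((Lp.memLp s).sub hfm).1]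
    exact ENNReal.toReal_le_of_le_ofReal (by positivity) hf.le
  -- the contribution of the bounded part `f` of the test function
  have hfb : MemLp (fun z => f z * (m u z * sqrtDensity μ P₀ z)) 2 μ :=
    MemLp.of_le_mul (c := K) hb (f.measurable.aestronglyMeasurable.mul hb.1)
      (Eventually.of_forall fun z => by
        rw [norm_mul]; exact mul_le_mul_of_nonneg_right (hK z) (norm_nonneg _))
  have hdd := (memLp_sqrtDensity hu.2).sub (memLp_sqrtDensity hP₀)
  have e2 := abs_integral_mul_le hfb hdd
  have e2' : (eLpNorm (fun z => f z * (m u z * sqrtDensity μ P₀ z)) 2 μ).toReal ≤ K * C := by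
    have : eLpNorm (fun z => f z * (m u z * sqrtDensity μ P₀ z)) 2 μ
        ≤ ENNReal.ofReal K * eLpNorm (fun z => m u z * sqrtDensity μ P₀ z) 2 μ := by
      apply eLpNorm_le_mul_eLpNorm_of_ae_le_mul
      refine Eventually.of_forall fun z => ?_
      rw [norm_mul]
      exact mul_le_mul_of_nonneg_right (hK z) (norm_nonneg _)
    rw [eLpNorm_mul_sqrtDensity hP₀ hC₀u.1.1] at this
    have h2 := ENNReal.toReal_mono (ENNReal.mul_ne_top ENNReal.ofReal_ne_top hC₀u.1.2.ne) this
    rw [ENNReal.toReal_mul, ENNReal.toReal_ofReal hK0.le] at h2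
    exact h2.trans (mul_le_mul_of_nonneg_left hC₀u.2 hK0.le)
  have hsplit : ∫ z, (m u z * sqrtDensity μ (P u) z - m u z * sqrtDensity μ P₀ z)
      * (s z * sqrtDensity μ P₀ z) ∂μ =
      ∫ z, ((fun z => m u z * sqrtDensity μ (P u) z) - fun z => m u z * sqrtDensity μ P₀ z) z *
        (((s : (Fin q → ℝ) → ℝ) - f) z * sqrtDensity μ P₀ z) ∂μ +
      ∫ z, (f z * (m u z * sqrtDensity μ P₀ z)) *
        (sqrtDensity μ (P u) - sqrtDensity μ P₀) z ∂μ := by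
    refine Eq.trans ?_ (integral_add (hab.integrable_mul hsf) (hfb.integrable_mul hdd))
    congr 1
    funext z
    simp only [Pi.sub_apply]
    ring
  rw [Real.dist_eq, sub_zero, hsplit]
  refine (abs_add_le _ _).trans_lt ?_
  have b1 : _ ≤ (C + C) * (ε / (8 * C)) :=
    e1.trans (mul_le_mul e1' e1'' ENNReal.toReal_nonneg (by positivity))
  have b2 : _ ≤ (K * C) * (ε / (4 * C * K)) :=
    e2.trans (mul_le_mul e2' hd.le ENNReal.toReal_nonneg (by positivity))
  have c1 : (C + C) * (ε / (8 * C)) = ε / 4 := by field_simp; ring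
  have c2 : (K * C) * (ε / (4 * C * K)) = ε / 4 := by field_simp
  rw [c1] at b1
  rw [c2] at b2
  linarith

/-- In finite dimensions, functionals that tend to zero pointwise do so uniformly on the unit
ball. -/
theorem isLittleO_of_tendsto_apply [FiniteDimensional ℝ E] {F : Type*} [NormedAddCommGroup F]
    [NormedSpace ℝ F] (S : E →L[ℝ] F) {Λ : E → F → ℝ}
    (hΛ : ∀ s, Tendsto (fun u => Λ u s) (𝓝 0) (𝓝 0))
    (hadd : ∀ᶠ u in 𝓝 0, ∃ L : F →ₗ[ℝ] ℝ, ∀ s, Λ u s = L s) :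
    (fun u => Λ u (S u)) =o[𝓝 0] fun u : E => u := by
  let b := Module.finBasis ℝ E
  have h1 : (fun u => ∑ i, b.coord i u * Λ u (S (b i))) =o[𝓝 0] fun u : E => u := by
    have hi : ∀ i, (fun u => b.coord i u * Λ u (S (b i))) =o[𝓝 0] fun u : E => u := fun i => by
      have hO : (fun u => b.coord i u) =O[𝓝 0] fun u : E => u :=
        ContinuousLinearMap.isBigO_id (LinearMap.toContinuousLinearMap (b.coord i)) _
      have ho : (fun u => Λ u (S (b i))) =o[𝓝 0] fun _ : E => (1 : ℝ) :=
        (Asymptotics.isLittleO_one_iff ℝ).2 (hΛ _)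
      have := hO.norm_right.mul_isLittleO ho
      simp only [mul_one] at this
      exact this.of_norm_right
    exact Asymptotics.IsLittleO.fun_sum fun i _ => hi i
  refine h1.congr' ?_ EventuallyEq.rfl
  filter_upwards [hadd] with u ⟨L, hL⟩
  have hu : S u = ∑ i, b.repr u i • S (b i) := by
    conv_lhs => rw [← b.sum_repr u]
    simp only [map_sum, map_smul]
  simp only [hu, hL, map_sum, map_smul, smul_eq_mul, Module.Basis.coord_apply]

/-- Along a path that is differentiable in quadratic mean, and for moment functions that are
bounded in mean square along it and mean-square continuous at `0`, the change of the moment due to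
the change of the law is linear in the score. -/
theorem DQM.hasFDerivAt_integral [FiniteDimensional ℝ E] [SigmaFinite μ] [IsProbabilityMeasure P₀]
    (hP₀ : P₀ ≪ μ) (hP : ∀ᶠ u in 𝓝 0, IsProbabilityMeasure (P u) ∧ P u ≪ μ) (h : DQM μ P₀ P S)
    (h0 : P 0 = P₀) {m : E → (Fin q → ℝ) → ℝ} (hm : ∀ u, Measurable (m u))
    (hb : ∃ C : ℝ≥0, ∀ᶠ u in 𝓝 0, eLpNorm (m u) 2 (P u) ≤ C)
    (hc : Tendsto (fun u => eLpNorm (fun z => m u z - m 0 z) 2 P₀) (𝓝 0) (𝓝 0))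
    (hm0 : MemLp (m 0) 2 P₀) :
    HasFDerivAt (fun u => ∫ z, m u z ∂P₀ - ∫ z, m u z ∂(P u))
      (-((innerSL ℝ (hm0.toLp (m 0))).comp S)) 0 := by
  obtain ⟨C, hC⟩ := hb
  -- a common bound for the second moments under `P u` and under `P₀`
  set B : ℝ := max C ((eLpNorm (m 0) 2 P₀).toReal + 1) with hB
  have hB0 : 0 < B := lt_of_lt_of_le (by positivity) (le_max_right _ _)
  have hdiff : ∀ᶠ u in 𝓝 0, MemLp (fun z => m u z - m 0 z) 2 P₀ := by
    filter_upwards [hc.eventually_lt_const (zero_lt_one (α := ℝ≥0∞))] with u hu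
    exact ⟨((hm u).sub (hm 0)).aestronglyMeasurable, hu.trans ENNReal.one_lt_top⟩
  have hC1 : ∀ᶠ u in 𝓝 0, MemLp (m u) 2 (P u) ∧ (eLpNorm (m u) 2 (P u)).toReal ≤ B := by
    filter_upwards [hC] with u hu
    refine ⟨⟨(hm u).aestronglyMeasurable, hu.trans_lt ENNReal.coe_lt_top⟩, ?_⟩
    refine le_trans ?_ (le_max_left _ _)
    simpa using ENNReal.toReal_mono ENNReal.coe_ne_top hu
  have hC2 : ∀ᶠ u in 𝓝 0, MemLp (m u) 2 P₀ ∧ (eLpNorm (m u) 2 P₀).toReal ≤ B := by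
    filter_upwards [hdiff, hc.eventually_lt_const (zero_lt_one (α := ℝ≥0∞))] with u hu hu1
    have e : m u = fun z => m 0 z + (m u z - m 0 z) := by funext z; ring
    refine ⟨by rw [e]; exact hm0.add hu, ?_⟩
    rw [e]
    refine (toReal_eLpNorm_add_le hm0 hu).trans (le_trans ?_ (le_max_right _ _))
    have := ENNReal.toReal_mono ENNReal.one_ne_top hu1.le
    rw [ENNReal.toReal_one] at this
    linarith
  rw [hasFDerivAt_iff_isLittleO_nhds_zero]
  have hzero : ∫ z, m 0 z ∂P₀ - ∫ z, m 0 z ∂(P 0) = 0 := by rw [h0, sub_self]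
  simp only [zero_add, hzero, sub_zero]
  set Λ : E → Lp ℝ 2 P₀ → ℝ := fun u s =>
    ∫ z, (m u z * sqrtDensity μ (P u) z - m u z * sqrtDensity μ P₀ z)
      * (s z * sqrtDensity μ P₀ z) ∂μ with hΛdef
  have hΛ : (fun u => Λ u (S u)) =o[𝓝 0] fun u : E => u := by
    refine isLittleO_of_tendsto_apply S (h.tendsto_integral_cross hP₀ hP hC1 hC2) ?_
    filter_upwards [hP, hC1, hC2] with u hu hu1 hu2
    have := hu.1
    have hab := (memLp_mul_sqrtDensity hu.2 hu1.1).sub (memLp_mul_sqrtDensity hP₀ hu2.1)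
    refine ⟨{ toFun := Λ u, map_add' := fun s t => ?_, map_smul' := fun c s => ?_ },
      fun s => rfl⟩
    · refine Eq.trans ?_ (integral_add
        (hab.integrable_mul (memLp_score_mul_sqrtDensity hP₀ s))
        (hab.integrable_mul (memLp_score_mul_sqrtDensity hP₀ t)))
      refine integral_congr_ae ?_
      filter_upwards [mul_sqrtDensity_congr hP₀ (Lp.coeFn_add s t)] with z hz
      simp only [hz, Pi.add_apply]
      ring
    · rw [RingHom.id_apply, smul_eq_mul, hΛdef, ← integral_const_mul]
      refine integral_congr_ae ?_
      filter_upwards [mul_sqrtDensity_congr hP₀ (Lp.coeFn_smul c s)] with z hz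
      simp only [hz, Pi.smul_apply, smul_eq_mul]
      ring
  have hR2 : (fun u => ∫ z, (m u z - m 0 z) * (S u) z ∂P₀) =o[𝓝 0] fun u : E => u := by
    have ho : (fun u => (eLpNorm (fun z => m u z - m 0 z) 2 P₀).toReal) =o[𝓝 0]
        fun _ : E => (1 : ℝ) := by
      rw [Asymptotics.isLittleO_one_iff]
      simpa [Function.comp_def] using (ENNReal.tendsto_toReal ENNReal.zero_ne_top).comp hc
    have hO := ho.mul_isBigO (S.isBigO_id (𝓝 0)).norm_norm
    refine Asymptotics.IsBigO.trans_isLittleO (Asymptotics.IsBigO.of_bound 1 ?_)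
      ((by simpa using hO : _ =o[𝓝 0] fun u : E => ‖u‖).of_norm_right)
    filter_upwards [hdiff] with u hu
    refine (abs_integral_mul_le hu (Lp.memLp (S u))).trans ?_
    rw [one_mul, ← Lp.norm_def]
    exact le_abs_self _
  have hR3 : (fun u => ∫ z, (m u z * sqrtDensity μ (P u) z + m u z * sqrtDensity μ P₀ z) *
      (sqrtDensity μ (P u) z - sqrtDensity μ P₀ z
        - (1 / 2 : ℝ) * (S u) z * sqrtDensity μ P₀ z) ∂μ) =o[𝓝 0] fun u : E => u := by
    rw [Asymptotics.isLittleO_iff]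
    intro c hc
    filter_upwards [hP, hC1, hC2, h (c / (B + B)) (by positivity)] with u hu hu1 hu2 hr
    have := hu.1
    have ha := memLp_mul_sqrtDensity hu.2 hu1.1
    have hb := memLp_mul_sqrtDensity hP₀ hu2.1
    refine (abs_integral_mul_le (ha.add hb) (memLp_remainder hP₀ hu.2 (S u))).trans ?_
    have e1 := toReal_eLpNorm_add_le ha hb
    rw [eLpNorm_mul_sqrtDensity hu.2 hu1.1.1, eLpNorm_mul_sqrtDensity hP₀ hu2.1.1] at e1
    have e2 := ENNReal.toReal_le_of_le_ofReal (by positivity) hr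
    calc _ ≤ (B + B) * (c / (B + B) * ‖u‖) :=
          mul_le_mul (e1.trans (add_le_add hu1.2 hu2.2)) e2 ENNReal.toReal_nonneg (by positivity)
      _ = c * ‖u‖ := by field_simp
  have hsum := ((hΛ.const_mul_left (1 / 2)).add hR2).add hR3
  refine (hsum.neg_left).congr' ?_ EventuallyEq.rfl
  filter_upwards [hP, hC1, hC2, hdiff] with u hu hu1 hu2 hud
  have := hu.1
  have ha := memLp_mul_sqrtDensity hu.2 hu1.1
  have hb := memLp_mul_sqrtDensity hP₀ hu2.1
  have hs := memLp_score_mul_sqrtDensity hP₀ (S u)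
  have hp := memLp_sqrtDensity hu.2
  have hp0 := memLp_sqrtDensity hP₀
  have i1 : (innerSL ℝ (hm0.toLp (m 0))).comp S u = ∫ z, m 0 z * (S u) z ∂P₀ := by
    rw [ContinuousLinearMap.comp_apply, innerSL_apply_apply, L2.inner_def]
    refine integral_congr_ae ?_
    filter_upwards [hm0.coeFn_toLp] with z hz
    simp [hz, mul_comm]
  have i2 : ∫ z, (m u z - m 0 z) * (S u) z ∂P₀
      = ∫ z, m u z * (S u) z ∂P₀ - ∫ z, m 0 z * (S u) z ∂P₀ := by
    refine Eq.trans ?_ (integral_sub (hu2.1.integrable_mul (Lp.memLp (S u)))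
      (hm0.integrable_mul (Lp.memLp (S u))))
    congr 1
    funext z
    exact sub_mul _ _ _
  have i3 : ∫ z, m u z * (S u) z ∂P₀ = ∫ z, (m u z * sqrtDensity μ P₀ z) *
      ((S u) z * sqrtDensity μ P₀ z) ∂μ := by
    rw [← integral_mul_sqrtDensity hP₀]
    congr 1
    funext z
    ring
  have i4 : ∫ z, m u z ∂(P u) = ∫ z, (m u z * sqrtDensity μ (P u) z) * sqrtDensity μ (P u) z ∂μ :=
    (integral_mul_sqrtDensity hu.2 _).symm
  have i5 : ∫ z, m u z ∂P₀ = ∫ z, (m u z * sqrtDensity μ P₀ z) * sqrtDensity μ P₀ z ∂μ :=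
    (integral_mul_sqrtDensity hP₀ _).symm
  -- the three terms add up by `m p_u - m p₀ = (m √p_u + m √p₀) (√p_u - √p₀)`
  have key : 1 / 2 * Λ u (S u) + ∫ z, (m u z * sqrtDensity μ P₀ z) *
      ((S u) z * sqrtDensity μ P₀ z) ∂μ +
      ∫ z, (m u z * sqrtDensity μ (P u) z + m u z * sqrtDensity μ P₀ z) *
      (sqrtDensity μ (P u) z - sqrtDensity μ P₀ z
        - (1 / 2 : ℝ) * (S u) z * sqrtDensity μ P₀ z) ∂μ
      = ∫ z, (m u z * sqrtDensity μ (P u) z) * sqrtDensity μ (P u) z ∂μ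
        - ∫ z, (m u z * sqrtDensity μ P₀ z) * sqrtDensity μ P₀ z ∂μ := by
    rw [hΛdef, ← integral_const_mul]
    have j1 := ((ha.sub hb).integrable_mul hs).const_mul (1 / 2 : ℝ)
    have j2 := hb.integrable_mul hs
    have j3 := (ha.add hb).integrable_mul (memLp_remainder hP₀ hu.2 (S u))
    have j4 := ha.integrable_mul hp
    have j5 := hb.integrable_mul hp0
    refine Eq.trans ?_ (integral_sub j4 j5)
    refine (congrArg₂ (· + ·) (integral_add j1 j2).symm rfl).trans ?_
    refine (integral_add (j1.add j2) j3).symm.trans ?_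
    congr 1
    funext z
    simp only [Pi.mul_apply, Pi.sub_apply, Pi.add_apply]
    ring
  rw [neg_apply, i1, i2, i3, i4, i5, ← sub_eq_zero]
  rw [← sub_eq_zero] at key
  linarith

end Differentiation

/-! ### Scores of regular submodels -/

section Scores

variable {q d J : ℕ} {p : Fin J → ℕ} {ι : Type*} {μ P₀ : Measure (Fin q → ℝ)}
  {Θ : Set (Fin d → ℝ)} {θ₀ : Fin d → ℝ} {M : Set ((Fin d → ℝ) × Measure (Fin q → ℝ))}
  {m : ι → (Fin q → ℝ) → (Fin d → ℝ) → ℝ}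
  {E F : Type*} [NormedAddCommGroup E] [NormedSpace ℝ E] [NormedAddCommGroup F] [NormedSpace ℝ F]
  {ϑ : E → Fin d → ℝ} {P : E → Measure (Fin q → ℝ)} {D : E →L[ℝ] (Fin d → ℝ)}
  {S : E →L[ℝ] Lp ℝ 2 P₀}

/-- The constant function `1`, as an element of `L²(P₀)`. -/
noncomputable def oneLp (P₀ : Measure (Fin q → ℝ)) [IsFiniteMeasure P₀] : Lp ℝ 2 P₀ :=
  (memLp_const (1 : ℝ)).toLp _

theorem inner_toLp_left {Ω : Type*} [MeasurableSpace Ω] {P : Measure Ω} {f : Ω → ℝ}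
    (hf : MemLp f 2 P) (h : Lp ℝ 2 P) : inner ℝ (hf.toLp f) h = ∫ z, f z * h z ∂P := by
  rw [L2.inner_def]
  refine integral_congr_ae ?_
  filter_upwards [hf.coeFn_toLp] with z hz
  simp [hz, mul_comm]

theorem inner_oneLp [IsFiniteMeasure P₀] (h : Lp ℝ 2 P₀) :
    inner ℝ (oneLp P₀) h = ∫ z, h z ∂P₀ := by
  rw [oneLp, inner_toLp_left]
  simp

namespace IsRegularSubmodel

/-- A regular submodel, composed with a linear map of the index spaces. -/
theorem comp_linear (h : IsRegularSubmodel μ P₀ θ₀ M m ϑ P D S) (L : F →L[ℝ] E) :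
    IsRegularSubmodel μ P₀ θ₀ M m (fun u => ϑ (L u)) (fun u => P (L u)) (D.comp L) (S.comp L) := by
  have hL : Tendsto L (𝓝 0) (𝓝 0) := by simpa using L.continuous.tendsto 0
  refine ⟨by simp [h.theta_zero], by simp [h.law_zero], hL.eventually h.mem, ?_, ?_, ?_, ?_⟩
  · have h1 : HasFDerivAt ϑ D (L 0) := by simpa using h.hasFDerivAt
    exact h1.comp 0 L.hasFDerivAt
  · intro ε hε
    filter_upwards [hL.eventually (h.dqm (ε / (‖L‖ + 1)) (by positivity))] with u hu
    refine hu.trans (ENNReal.ofReal_le_ofReal ?_)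
    have h1 := L.le_opNorm u
    have h2 : ‖L‖ * ‖u‖ ≤ (‖L‖ + 1) * ‖u‖ := by
      have := norm_nonneg u
      nlinarith
    calc ε / (‖L‖ + 1) * ‖L u‖ ≤ ε / (‖L‖ + 1) * ((‖L‖ + 1) * ‖u‖) := by gcongr; linarith
      _ = ε * ‖u‖ := by field_simp
  · intro i
    obtain ⟨C, hC⟩ := h.moment_bounded i
    exact ⟨C, hL.eventually hC⟩
  · intro i
    exact (h.moment_continuous i).comp hL

theorem isTangent {ϑ : (Fin d → ℝ) → Fin d → ℝ} {P : (Fin d → ℝ) → Measure (Fin q → ℝ)}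
    {S : (Fin d → ℝ) →L[ℝ] Lp ℝ 2 P₀}
    (h : IsRegularSubmodel μ P₀ θ₀ M m ϑ P (ContinuousLinearMap.id ℝ _) S) (v : Fin d → ℝ) :
    IsTangent μ P₀ θ₀ M m v (S v) :=
  ⟨_, _, _, _, h.comp_linear (ContinuousLinearMap.toSpanSingleton ℝ v), by simp, by simp⟩

theorem memLp (h : IsRegularSubmodel μ P₀ θ₀ M m ϑ P D S)
    (hm : ∀ a θ, Measurable fun z => m a z θ) (a : ι) : MemLp (fun z => m a z θ₀) 2 P₀ := by
  obtain ⟨C, hC⟩ := h.moment_bounded a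
  have := hC.self_of_nhds
  rw [h.theta_zero, h.law_zero] at this
  exact ⟨(hm a θ₀).aestronglyMeasurable, this.trans_lt ENNReal.coe_lt_top⟩

/-- The conditional moment restriction given `X⁽ʲ⁾` contains the unconditional restrictions with
the indicator functions of the events in the σ-algebra of `X⁽ʲ⁾` as instruments. -/
theorem indicator_moment {X : Fin J → Finset (Fin q)}
    {g : (j : Fin J) → (Fin q → ℝ) → (Fin d → ℝ) → Fin (p j) → ℝ}
    (h : IsRegularSubmodel μ P₀ θ₀ (conditionalModel μ Θ X g) (stacked g) ϑ P D S)
    (j : Fin J) (i : Fin (p j)) {B : Set (Fin q → ℝ)} (hB : MeasurableSet[coordSigma (X j)] B) :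
    IsRegularSubmodel μ P₀ θ₀
      (unconditionalModel μ Θ fun (_ : Unit) z θ => B.indicator (fun z => g j z θ i) z)
      (fun (_ : Unit) z θ => B.indicator (fun z => g j z θ i) z) ϑ P D S := by
  have hle : coordSigma (X j) ≤ MeasurableSpace.pi := Measurable.comap_le (by fun_prop)
  have hBm : MeasurableSet B := hle _ hB
  refine ⟨h.theta_zero, h.law_zero, ?_, h.hasFDerivAt, h.dqm, ?_, ?_⟩
  · filter_upwards [h.mem] with u ⟨h1, h2, h3, h4⟩
    refine ⟨h1, h2, h3, fun _ => ⟨(h4 j i).1.indicator hBm, ?_⟩⟩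
    have h2' : IsProbabilityMeasure (P u) := h2
    rw [integral_indicator hBm, ← setIntegral_condExp hle (h4 j i).1 hB]
    rw [setIntegral_congr_ae (g := fun _ => 0) hBm ((h4 j i).2.mono fun z hz _ => hz)]
    simp
  · intro _
    obtain ⟨C, hC⟩ := h.moment_bounded ⟨j, i⟩
    exact ⟨C, hC.mono fun u hu => (eLpNorm_indicator_le _).trans hu⟩
  · intro _
    refine tendsto_of_tendsto_of_tendsto_of_le_of_le tendsto_const_nhds
      (h.moment_continuous ⟨j, i⟩) (fun _ => zero_le) fun u => ?_
    refine le_trans (le_of_eq ?_) (eLpNorm_indicator_le (s := B)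
      (fun z => stacked g ⟨j, i⟩ z (ϑ u) - stacked g ⟨j, i⟩ z θ₀))
    congr 1
    funext z
    by_cases hz : z ∈ B <;> simp [hz, stacked]

variable [SigmaFinite μ] [IsProbabilityMeasure P₀]

/-- Scores have mean zero. -/
theorem inner_one_score [FiniteDimensional ℝ E] (h : IsRegularSubmodel μ P₀ θ₀ M m ϑ P D S)
    (hM : ∀ x ∈ M, IsProbabilityMeasure x.2 ∧ x.2 ≪ μ) (u : E) :
    inner ℝ (oneLp P₀) (S u) = 0 := by
  have hP := h.mem.mono fun u hu => hM _ hu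
  have hP₀ : P₀ ≪ μ := by simpa [h.law_zero] using hP.self_of_nhds.2
  have hd := DQM.hasFDerivAt_integral hP₀ hP h.dqm h.law_zero (m := fun _ _ => (1 : ℝ))
    (fun _ => measurable_const) ⟨1, by
      filter_upwards [hP] with u hu
      have := hu.1
      rw [eLpNorm_const _ (by norm_num) (IsProbabilityMeasure.ne_zero _)]
      simp⟩ (by simp) (memLp_const 1)
  have hz : (fun u => ∫ _, (1 : ℝ) ∂P₀ - ∫ _, (1 : ℝ) ∂(P u)) =ᶠ[𝓝 0] fun _ => 0 := by
    filter_upwards [hP] with u hu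
    have := hu.1
    simp
  have h0 := (hd.congr_of_eventuallyEq hz.symm).unique (hasFDerivAt_const (0 : ℝ) (0 : E))
  have := DFunLike.congr_fun h0 u
  rw [neg_apply, ContinuousLinearMap.comp_apply, innerSL_apply_apply, zero_apply,
    neg_eq_zero] at this
  exact this

/-- Along a regular submodel of an unconditional moment model, the derivative of
`u ↦ E[m(Z, θ_u)]` is minus the covariance of the moment function and the score. -/
theorem hasFDerivAt_moment [FiniteDimensional ℝ E]
    (h : IsRegularSubmodel μ P₀ θ₀ (unconditionalModel μ Θ m) m ϑ P D S)
    (hm : ∀ a θ, Measurable fun z => m a z θ) (a : ι) :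
    HasFDerivAt (fun u => ∫ z, m a z (ϑ u) ∂P₀)
      (-((innerSL ℝ ((h.memLp hm a).toLp _)).comp S)) 0 := by
  have hP : ∀ᶠ u in 𝓝 0, IsProbabilityMeasure (P u) ∧ P u ≪ μ :=
    h.mem.mono fun u hu => ⟨hu.2.1, hu.2.2.1⟩
  have hP₀ : P₀ ≪ μ := by simpa [h.law_zero] using hP.self_of_nhds.2
  have e0 : (fun z => m a z (ϑ 0)) = fun z => m a z θ₀ := by rw [h.theta_zero]
  have hm0 : MemLp (fun z => m a z (ϑ 0)) 2 P₀ := by rw [e0]; exact h.memLp hm a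
  have hd := DQM.hasFDerivAt_integral hP₀ hP h.dqm h.law_zero (m := fun u z => m a z (ϑ u))
    (fun u => hm a _) (h.moment_bounded a) (by
      have := h.moment_continuous a
      rwa [← h.theta_zero] at this) hm0
  have e1 : hm0.toLp (fun z => m a z (ϑ 0)) = (h.memLp hm a).toLp _ := by
    congr 1
  rw [e1] at hd
  refine hd.congr_of_eventuallyEq ?_
  filter_upwards [h.mem] with u hu
  rw [(hu.2.2.2 a).2, sub_zero]

/-- The derivative of `θ ↦ E[m(Z, θ)]` at `θ₀`, read off from a submodel parametrized by `θ`. -/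
theorem hasFDerivAt_moment_theta {Q : (Fin d → ℝ) → Measure (Fin q → ℝ)}
    {S : (Fin d → ℝ) →L[ℝ] Lp ℝ 2 P₀}
    (h : IsRegularSubmodel μ P₀ θ₀ (unconditionalModel μ Θ m) m (fun u => θ₀ + u) Q
      (ContinuousLinearMap.id ℝ (Fin d → ℝ)) S)
    (hm : ∀ a θ, Measurable fun z => m a z θ) (a : ι) :
    HasFDerivAt (fun θ => ∫ z, m a z θ ∂P₀)
      (-((innerSL ℝ ((h.memLp hm a).toLp _)).comp S)) θ₀ := by
  have h1 := h.hasFDerivAt_moment hm a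
  have h2 : HasFDerivAt (fun θ : Fin d → ℝ => θ - θ₀) (ContinuousLinearMap.id ℝ (Fin d → ℝ)) θ₀ :=
    (hasFDerivAt_id θ₀).sub_const θ₀
  have h3 : HasFDerivAt (fun u => ∫ z, m a z (θ₀ + u) ∂P₀)
      (-((innerSL ℝ ((h.memLp hm a).toLp _)).comp S)) (θ₀ - θ₀) := by rwa [sub_self]
  have h4 := HasFDerivAt.comp (f := fun θ : Fin d → ℝ => θ - θ₀) θ₀ h3 h2
  simpa [Function.comp_def] using h4

/-- The score of a submodel differs from the score for `θ`, in the direction in which `θ` moves, by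
a function that is orthogonal to the moment functions. -/
theorem inner_moment_score_sub {Q : (Fin d → ℝ) → Measure (Fin q → ℝ)}
    {S : (Fin d → ℝ) →L[ℝ] Lp ℝ 2 P₀}
    (h : IsRegularSubmodel μ P₀ θ₀ (unconditionalModel μ Θ m) m (fun u => θ₀ + u) Q
      (ContinuousLinearMap.id ℝ (Fin d → ℝ)) S)
    {ϑ : ℝ → Fin d → ℝ} {P : ℝ → Measure (Fin q → ℝ)} {D : ℝ →L[ℝ] (Fin d → ℝ)}
    {s : ℝ →L[ℝ] Lp ℝ 2 P₀}
    (h' : IsRegularSubmodel μ P₀ θ₀ (unconditionalModel μ Θ m) m ϑ P D s)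
    (hm : ∀ a θ, Measurable fun z => m a z θ) (a : ι) :
    ∫ z, m a z θ₀ * (s 1 - S (D 1) : Lp ℝ 2 P₀) z ∂P₀ = 0 := by
  have h1 := h.hasFDerivAt_moment_theta hm a
  have hcomp : ∀ L : (Fin d → ℝ) →L[ℝ] ℝ, HasFDerivAt (fun θ => ∫ z, m a z θ ∂P₀) L θ₀ →
      HasFDerivAt (fun u => ∫ z, m a z (ϑ u) ∂P₀) (L.comp D) 0 := fun L hL => by
    rw [← h'.theta_zero] at hL
    exact hL.comp 0 h'.hasFDerivAt
  have h2 := (hcomp _ h1).unique (h'.hasFDerivAt_moment hm a)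
  have h3 := DFunLike.congr_fun h2 1
  rw [← inner_toLp_left (h.memLp hm a), inner_sub_right, sub_eq_zero]
  simpa using h3.symm

end IsRegularSubmodel

end Scores

/-! ### Bounded scores -/

section BoundedScores

variable {q d J : ℕ} {p : Fin J → ℕ} {ι : Type*} {μ P₀ : Measure (Fin q → ℝ)}
  {Θ : Set (Fin d → ℝ)} {θ₀ : Fin d → ℝ} {M : Set ((Fin d → ℝ) × Measure (Fin q → ℝ))}
  {m : ι → (Fin q → ℝ) → (Fin d → ℝ) → ℝ} {h : (Fin q → ℝ) → ℝ} {C t : ℝ}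

/-- The law with density `1 + t h` with respect to `P₀`. It is meant for `|t h| ≤ 1`; the density is
cut off at `0` otherwise. -/
noncomputable def linearTilt (P₀ : Measure (Fin q → ℝ)) (h : (Fin q → ℝ) → ℝ) (t : ℝ) :
    Measure (Fin q → ℝ) :=
  P₀.withDensity fun z => ENNReal.ofReal (1 + t * h z)

theorem measurable_linearTilt_density (hh : Measurable h) (t : ℝ) :
    Measurable fun z => ENNReal.ofReal (1 + t * h z) := by fun_prop

theorem abs_mul_le_one (hb : ∀ z, |h z| ≤ C) (ht : |t| * C ≤ 1) (z : Fin q → ℝ) :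
    |t * h z| ≤ 1 := by
  rw [abs_mul]
  exact (mul_le_mul_of_nonneg_left (hb z) (abs_nonneg t)).trans ht

theorem linearTilt_density_nonneg (hb : ∀ z, |h z| ≤ C) (ht : |t| * C ≤ 1) (z : Fin q → ℝ) :
    0 ≤ 1 + t * h z := by
  have := (abs_le.1 (abs_mul_le_one hb ht z)).1
  linarith

theorem linearTilt_le (hb : ∀ z, |h z| ≤ C) (ht : |t| * C ≤ 1) :
    linearTilt P₀ h t ≤ (2 : ℝ≥0∞) • P₀ := by
  rw [linearTilt, ← withDensity_const]
  refine withDensity_mono (Eventually.of_forall fun z => ?_)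
  have := (abs_le.1 (abs_mul_le_one hb ht z)).2
  refine ENNReal.ofReal_le_of_le_toReal ?_
  simp only [ENNReal.toReal_ofNat]
  linarith

theorem integral_linearTilt (hh : Measurable h) (hb : ∀ z, |h z| ≤ C) (ht : |t| * C ≤ 1)
    (f : (Fin q → ℝ) → ℝ) :
    ∫ z, f z ∂(linearTilt P₀ h t) = ∫ z, (1 + t * h z) * f z ∂P₀ := by
  rw [linearTilt, integral_withDensity_eq_integral_toReal_smul
    (measurable_linearTilt_density hh t) (by simp)]
  congr 1
  funext z
  rw [ENNReal.toReal_ofReal (linearTilt_density_nonneg hb ht z), smul_eq_mul]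

theorem integrable_linearTilt (hb : ∀ z, |h z| ≤ C) (ht : |t| * C ≤ 1)
    {f : (Fin q → ℝ) → ℝ} (hf : Integrable f P₀) : Integrable f (linearTilt P₀ h t) :=
  (hf.smul_measure (by norm_num : (2 : ℝ≥0∞) ≠ ∞)).mono_measure (linearTilt_le hb ht)

/-- If `f` and `f h` have integral zero under `P₀`, then so has `f` under the tilted law. -/
theorem integral_linearTilt_eq_zero (hh : Measurable h) (hb : ∀ z, |h z| ≤ C)
    (ht : |t| * C ≤ 1) {f : (Fin q → ℝ) → ℝ} (hf : Integrable f P₀) (h0 : ∫ z, f z ∂P₀ = 0)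
    (h1 : ∫ z, f z * h z ∂P₀ = 0) : ∫ z, f z ∂(linearTilt P₀ h t) = 0 := by
  rw [integral_linearTilt hh hb ht]
  have hfh : Integrable (fun z => f z * h z) P₀ :=
    hf.mul_bdd (c := C) hh.aestronglyMeasurable (Eventually.of_forall hb)
  calc ∫ z, (1 + t * h z) * f z ∂P₀ = ∫ z, f z + t * (f z * h z) ∂P₀ := by
        congr 1; funext z; ring
    _ = 0 := by
        rw [integral_add hf (hfh.const_mul t), integral_const_mul, h0, h1, mul_zero, add_zero]

theorem isProbabilityMeasure_linearTilt [IsProbabilityMeasure P₀] (hh : Measurable h)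
    (hb : ∀ z, |h z| ≤ C) (ht : |t| * C ≤ 1) (h0 : ∫ z, h z ∂P₀ = 0) :
    IsProbabilityMeasure (linearTilt P₀ h t) := by
  have hint : Integrable h P₀ :=
    Integrable.of_bound hh.aestronglyMeasurable C (Eventually.of_forall hb)
  have hi : Integrable (fun z => 1 + t * h z) P₀ := (integrable_const 1).add (hint.const_mul t)
  constructor
  rw [linearTilt, withDensity_apply _ MeasurableSet.univ, Measure.restrict_univ,
    ← ofReal_integral_eq_lintegral_ofReal hi
      (Eventually.of_forall (linearTilt_density_nonneg hb ht))]
  have : ∫ z, (1 + t * h z) ∂P₀ = 1 := by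
    rw [integral_add (integrable_const 1) (hint.const_mul t), integral_const_mul, h0]
    simp
  rw [this, ENNReal.ofReal_one]

theorem abs_sqrt_one_add_sub_le {x : ℝ} (hx : -1 ≤ x) : |√(1 + x) - 1 - 1 / 2 * x| ≤ x ^ 2 := by
  set y := √(1 + x) with hy
  have hy0 : 0 ≤ y := Real.sqrt_nonneg _
  have hx' : x = y ^ 2 - 1 := by rw [hy, Real.sq_sqrt (by linarith)]; ring
  rw [hx', abs_le]
  constructor <;> nlinarith [sq_nonneg (y - 1), sq_nonneg (y ^ 2 - 1), mul_nonneg hy0 hy0,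
    mul_nonneg (sq_nonneg (y - 1)) hy0, mul_nonneg (sq_nonneg (y - 1)) (mul_nonneg hy0 hy0)]

theorem sqrtDensity_linearTilt [SigmaFinite μ] [IsFiniteMeasure P₀] (hP₀ : P₀ ≪ μ)
    (hh : Measurable h) (hb : ∀ z, |h z| ≤ C) (ht : |t| * C ≤ 1) :
    sqrtDensity μ (linearTilt P₀ h t) =ᵐ[μ] fun z => √(1 + t * h z) * sqrtDensity μ P₀ z := by
  filter_upwards [Measure.rnDeriv_withDensity_left_of_absolutelyContinuous hP₀
    (measurable_linearTilt_density hh t).aemeasurable] with z hz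
  have h0 := linearTilt_density_nonneg hb ht z
  rw [sqrtDensity, linearTilt, hz, ENNReal.toReal_mul, ENNReal.toReal_ofReal h0,
    Real.sqrt_mul h0, sqrtDensity]

theorem exists_bounded_representative (f : Lp ℝ 2 P₀) (hb : ∃ C, ∀ᵐ z ∂P₀, |f z| ≤ C) :
    ∃ (h : (Fin q → ℝ) → ℝ) (C : ℝ), Measurable h ∧ (∀ z, |h z| ≤ C) ∧ f =ᵐ[P₀] h := by
  obtain ⟨C, hC⟩ := hb
  have hf := (Lp.stronglyMeasurable f).measurable
  have hS : MeasurableSet {z | |f z| ≤ C} := measurableSet_le hf.abs measurable_const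
  refine ⟨{z | |f z| ≤ C}.indicator f, max C 0, hf.indicator hS, fun z => ?_, ?_⟩
  · by_cases hz : |f z| ≤ C
    · rw [Set.indicator_of_mem (by exact hz)]
      exact hz.trans (le_max_left _ _)
    · rw [Set.indicator_of_notMem (by exact hz), abs_zero]
      exact le_max_right _ _
  · filter_upwards [hC] with z hz
    rw [Set.indicator_of_mem (by exact hz)]

/-- A bounded function `h` of mean zero is the score of the path `t ↦ (1 + t h) P₀`, with the
parameter fixed, as soon as this path stays in the model. -/
theorem isTangent_of_bounded [SigmaFinite μ] [IsProbabilityMeasure P₀] (hP₀ : P₀ ≪ μ)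
    (hh : Measurable h) (hb : ∀ z, |h z| ≤ C) (hh2 : MemLp h 2 P₀)
    (hm : ∀ a, MemLp (fun z => m a z θ₀) 2 P₀)
    (hmem : ∀ t : ℝ, |t| * C ≤ 1 → (θ₀, linearTilt P₀ h t) ∈ M) :
    IsTangent μ P₀ θ₀ M m 0 (hh2.toLp h) := by
  have hC : 0 ≤ C := (abs_nonneg _).trans (hb 0)
  have hsmall : ∀ᶠ t : ℝ in 𝓝 0, |t| * C ≤ 1 := by
    have : Tendsto (fun t : ℝ => |t| * C) (𝓝 0) (𝓝 0) := by
      have : Continuous fun t : ℝ => |t| * C := by fun_prop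
      simpa using this.tendsto 0
    exact (this.eventually_lt_const one_pos).mono fun t ht => ht.le
  refine ⟨fun _ => θ₀, linearTilt P₀ h, 0, ContinuousLinearMap.toSpanSingleton ℝ (hh2.toLp h),
    ⟨rfl, by simp [linearTilt], hsmall.mono hmem, hasFDerivAt_const _ _, ?_, ?_, ?_⟩, rfl, by simp⟩
  · intro ε hε
    have hlim : ∀ᶠ t : ℝ in 𝓝 0, |t| * C ^ 2 ≤ ε := by
      have : Tendsto (fun t : ℝ => |t| * C ^ 2) (𝓝 0) (𝓝 0) := by
        have : Continuous fun t : ℝ => |t| * C ^ 2 := by fun_prop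
        simpa using this.tendsto 0
      exact (this.eventually_lt_const hε).mono fun t ht => ht.le
    filter_upwards [hsmall, hlim] with t ht htε
    have hle : ∀ᵐ z ∂μ, ‖sqrtDensity μ (linearTilt P₀ h t) z - sqrtDensity μ P₀ z
        - (1 / 2 : ℝ) * (ContinuousLinearMap.toSpanSingleton ℝ (hh2.toLp h) t : Lp ℝ 2 P₀) z
          * sqrtDensity μ P₀ z‖ ≤ (ε * ‖t‖) * ‖sqrtDensity μ P₀ z‖ := by
      have hs : (ContinuousLinearMap.toSpanSingleton ℝ (hh2.toLp h) t : Lp ℝ 2 P₀) =ᵐ[P₀]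
          fun z => t * h z := by
        rw [ContinuousLinearMap.toSpanSingleton_apply]
        filter_upwards [Lp.coeFn_smul t (hh2.toLp h), hh2.coeFn_toLp] with z h1 h2
        rw [h1, Pi.smul_apply, h2, smul_eq_mul]
      filter_upwards [sqrtDensity_linearTilt hP₀ hh hb ht, mul_sqrtDensity_congr hP₀ hs]
        with z h1 h2
      rw [h1, mul_assoc (1 / 2 : ℝ), h2]
      have e : √(1 + t * h z) * sqrtDensity μ P₀ z - sqrtDensity μ P₀ z
          - 1 / 2 * (t * h z * sqrtDensity μ P₀ z)
          = (√(1 + t * h z) - 1 - 1 / 2 * (t * h z)) * sqrtDensity μ P₀ z := by ring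
      rw [e, norm_mul]
      refine mul_le_mul_of_nonneg_right ?_ (norm_nonneg _)
      have h3 := abs_sqrt_one_add_sub_le (x := t * h z)
        (by have := linearTilt_density_nonneg hb ht z; linarith)
      refine (Real.norm_eq_abs _).le.trans (h3.trans ?_)
      have h4 : h z ^ 2 ≤ C ^ 2 := sq_le_sq' (abs_le.1 (hb z)).1 (abs_le.1 (hb z)).2
      calc (t * h z) ^ 2 = |t| * (|t| * h z ^ 2) := by rw [mul_pow, ← sq_abs t]; ring
        _ ≤ |t| * (|t| * C ^ 2) := by gcongr
        _ ≤ |t| * ε := by gcongr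
        _ = ε * ‖t‖ := by rw [Real.norm_eq_abs, mul_comm]
    refine (eLpNorm_le_mul_eLpNorm_of_ae_le_mul hle 2).trans (le_of_eq ?_)
    have h1 := eLpNorm_mul_sqrtDensity hP₀ (aestronglyMeasurable_const (b := (1 : ℝ)))
    simp only [one_mul] at h1
    change _ * eLpNorm (fun z => sqrtDensity μ P₀ z) 2 μ = _
    rw [h1, eLpNorm_const _ (by norm_num) (IsProbabilityMeasure.ne_zero _)]
    simp
  · intro a
    have h2 := (hm a).smul_measure (by norm_num : (2 : ℝ≥0∞) ≠ ∞)
    refine ⟨(eLpNorm (fun z => m a z θ₀) 2 ((2 : ℝ≥0∞) • P₀)).toNNReal, ?_⟩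
    filter_upwards [hsmall] with t ht
    rw [ENNReal.coe_toNNReal h2.2.ne]
    exact eLpNorm_mono_measure _ (linearTilt_le hb ht)
  · intro a
    simp

variable [SigmaFinite μ] [IsProbabilityMeasure P₀]

/-- A bounded function of mean zero, orthogonal to the moment functions, is a score in the model
given by unconditional moment equations. -/
theorem isTangent_unconditionalModel (hP : (θ₀, P₀) ∈ unconditionalModel μ Θ m)
    (hm : ∀ a, MemLp (fun z => m a z θ₀) 2 P₀) (f : Lp ℝ 2 P₀)
    (hb : ∃ C, ∀ᵐ z ∂P₀, |f z| ≤ C) (h1 : ∫ z, f z ∂P₀ = 0)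
    (h2 : ∀ a, ∫ z, m a z θ₀ * f z ∂P₀ = 0) :
    IsTangent μ P₀ θ₀ (unconditionalModel μ Θ m) m 0 f := by
  obtain ⟨h, C, hh, hb, hfh⟩ := exists_bounded_representative f hb
  have hh2 : MemLp h 2 P₀ := (Lp.memLp f).ae_eq hfh
  have e : f = hh2.toLp h := by
    rw [← Lp.toLp_coeFn f (Lp.memLp f)]
    exact (MemLp.toLp_eq_toLp_iff _ _).2 hfh
  rw [integral_congr_ae hfh] at h1
  rw [e]
  refine isTangent_of_bounded hP.2.2.1 hh hb hh2 hm fun t ht => ⟨hP.1,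
    isProbabilityMeasure_linearTilt hh hb ht h1,
    (withDensity_absolutelyContinuous _ _).trans hP.2.2.1, fun a =>
    ⟨integrable_linearTilt hb ht (hP.2.2.2 a).1, integral_linearTilt_eq_zero hh hb ht
      (hP.2.2.2 a).1 (hP.2.2.2 a).2 ?_⟩⟩
  rw [← h2 a]
  refine integral_congr_ae ?_
  filter_upwards [hfh] with z hz
  rw [hz]

/-- A bounded function of mean zero, orthogonal to the moment functions conditionally on each
conditioning vector, is a score in the model given by conditional moment equations. -/
theorem isTangent_conditionalModel {X : Fin J → Finset (Fin q)}
    {g : (j : Fin J) → (Fin q → ℝ) → (Fin d → ℝ) → Fin (p j) → ℝ}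
    (hP : (θ₀, P₀) ∈ conditionalModel μ Θ X g)
    (hm : ∀ j i, MemLp (fun z => g j z θ₀ i) 2 P₀) (f : Lp ℝ 2 P₀)
    (hb : ∃ C, ∀ᵐ z ∂P₀, |f z| ≤ C) (h1 : ∫ z, f z ∂P₀ = 0)
    (h2 : ∀ j i, P₀[fun z => g j z θ₀ i * f z | coordSigma (X j)] =ᵐ[P₀] 0) :
    IsTangent μ P₀ θ₀ (conditionalModel μ Θ X g) (stacked g) 0 f := by
  obtain ⟨h, C, hh, hb, hfh⟩ := exists_bounded_representative f hb
  have hh2 : MemLp h 2 P₀ := (Lp.memLp f).ae_eq hfh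
  have e : f = hh2.toLp h := by
    rw [← Lp.toLp_coeFn f (Lp.memLp f)]
    exact (MemLp.toLp_eq_toLp_iff _ _).2 hfh
  rw [integral_congr_ae hfh] at h1
  rw [e]
  refine isTangent_of_bounded hP.2.2.1 hh hb hh2 (fun a => hm a.1 a.2) fun t ht => ?_
  have hprob := isProbabilityMeasure_linearTilt hh hb ht h1
  refine ⟨hP.1, hprob, (withDensity_absolutelyContinuous _ _).trans hP.2.2.1, fun j i => ?_⟩
  have hint := integrable_linearTilt hb ht (hP.2.2.2 j i).1
  have hle : coordSigma (X j) ≤ MeasurableSpace.pi := Measurable.comap_le (by fun_prop)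
  refine ⟨hint, EventuallyEq.symm ?_⟩
  refine ae_eq_condExp_of_forall_setIntegral_eq hle hint (fun _ _ _ => integrableOn_zero)
    (fun B hB _ => ?_) aestronglyMeasurable_zero
  have hBm : MeasurableSet B := hle _ hB
  simp only [Pi.zero_apply, integral_zero]
  rw [← integral_indicator hBm]
  refine (integral_linearTilt_eq_zero hh hb ht ((hP.2.2.2 j i).1.indicator hBm) ?_ ?_).symm
  · rw [integral_indicator hBm, ← setIntegral_condExp hle (hP.2.2.2 j i).1 hB,
      setIntegral_congr_ae (g := fun _ => 0) hBm ((hP.2.2.2 j i).2.mono fun z hz _ => hz)]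
    simp
  · have hgf : Integrable (fun z => g j z θ₀ i * f z) P₀ := (hm j i).integrable_mul (Lp.memLp f)
    have := setIntegral_condExp hle hgf hB
    rw [setIntegral_congr_ae (g := fun _ => 0) hBm ((h2 j i).mono fun z hz _ => hz)] at this
    simp only [integral_zero] at this
    rw [this, ← integral_indicator hBm]
    refine integral_congr_ae ?_
    filter_upwards [hfh] with z hz
    by_cases hzB : z ∈ B <;> simp [hzB, hz]

end BoundedScores

/-! ### The information as a Gram matrix of projected scores -/

section Hilbert

variable {H : Type*} [NormedAddCommGroup H] [InnerProductSpace ℝ H] {n ι : Type*}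

theorem gram_transpose (x : n → H) : (Matrix.gram ℝ x).transpose = Matrix.gram ℝ x := by
  ext l l'
  simp [Matrix.gram_apply, real_inner_comm]

variable [Fintype ι]

theorem inner_sum_smul_gram [Fintype n] (x : n → H) (c : n → ℝ) (l : n) :
    inner ℝ (x l) (∑ k, c k • x k) = (Matrix.gram ℝ x).mulVec c l := by
  simp only [inner_sum, inner_smul_right, Matrix.mulVec, dotProduct, Matrix.gram_apply]
  exact Finset.sum_congr rfl fun k _ => mul_comm _ _

theorem gram_sum_smul (x : ι → H) (A : Matrix n ι ℝ) :
    Matrix.gram ℝ (fun l => ∑ k, A l k • x k) = A * Matrix.gram ℝ x * A.transpose := by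
  ext l l'
  simp only [Matrix.gram_apply, sum_inner, inner_sum, inner_smul_left, inner_smul_right,
    Matrix.mul_apply, Matrix.transpose_apply, Finset.sum_mul, RCLike.conj_to_real, Finset.mul_sum]
  refine Finset.sum_congr rfl fun k _ => Finset.sum_congr rfl fun k' _ => by ring

theorem dotProduct_gram_mulVec [Fintype n] (x : n → H) (c : n → ℝ) :
    dotProduct c ((Matrix.gram ℝ x).mulVec c) = ‖∑ k, c k • x k‖ ^ 2 := by
  rw [← real_inner_self_eq_norm_sq, sum_inner]
  simp only [dotProduct, inner_smul_left, RCLike.conj_to_real]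
  exact Finset.sum_congr rfl fun l _ => by rw [inner_sum_smul_gram]

/-- The Gram matrix of the projections of `x` to the span of `o` and a family `e`, where `o` is
orthogonal to `x` and `e`: with a generalized inverse `G` of the Gram matrix of `e`, it is `B' G B`,
where `B` is the matrix of inner products of `e` and `x`. -/
theorem gram_starProjection_eq {o : H} (e : ι → H) (x : n → H)
    [(Submodule.span ℝ (insert o (Set.range e))).HasOrthogonalProjection]
    (hoe : ∀ a, inner ℝ o (e a) = 0) (hox : ∀ l, inner ℝ o (x l) = 0)
    {G : Matrix ι ι ℝ} (hG : Matrix.gram ℝ e * G * Matrix.gram ℝ e = Matrix.gram ℝ e) :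
    Matrix.gram ℝ (fun l => (Submodule.span ℝ (insert o (Set.range e))).starProjection (x l)) =
      (Matrix.of fun a l => inner ℝ (e a) (x l)).transpose * G *
        Matrix.of fun a l => inner ℝ (e a) (x l) := by
  have hfin : FiniteDimensional ℝ (Submodule.span ℝ (Set.range e)) :=
    FiniteDimensional.span_of_finite ℝ (Set.finite_range e)
  have hmem : ∀ l, ∃ c : ι → ℝ, ∑ a, c a • e a
      = (Submodule.span ℝ (Set.range e)).starProjection (x l) := fun l =>
    (Submodule.mem_span_range_iff_exists_fun ℝ).1 (Submodule.starProjection_apply_mem _ _)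
  choose A hA using hmem
  have horth : ∀ l a, inner ℝ (e a) (x l - ∑ b, A l b • e b) = 0 := fun l a => by
    rw [hA]
    exact (Submodule.mem_orthogonal _ _).1 (Submodule.sub_starProjection_mem_orthogonal (x l)) _
      (Submodule.subset_span ⟨a, rfl⟩)
  have hproj : ∀ l, (Submodule.span ℝ (insert o (Set.range e))).starProjection (x l)
      = ∑ a, A l a • e a := fun l => by
    refine Submodule.eq_starProjection_of_mem_orthogonal ?_ ?_
    · exact Submodule.sum_mem _ fun a _ => Submodule.smul_mem _ _
        (Submodule.subset_span (Set.mem_insert_of_mem _ ⟨a, rfl⟩))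
    · rw [Submodule.mem_orthogonal]
      intro u hu
      induction hu using Submodule.span_induction with
      | mem u hu =>
        rcases hu with rfl | ⟨a, rfl⟩
        · simp [inner_sub_right, hox, inner_sum, inner_smul_right, hoe]
        · exact horth l a
      | zero => exact inner_zero_left _
      | add u v _ _ hu hv => rw [inner_add_left, hu, hv, add_zero]
      | smul c u _ hu => rw [inner_smul_left, hu, mul_zero]
  have hB : (Matrix.of fun a l => inner ℝ (e a) (x l) : Matrix ι n ℝ)
      = Matrix.gram ℝ e * (Matrix.of A).transpose := by
    ext a l
    have := horth l a
    rw [inner_sub_right, sub_eq_zero] at this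
    rw [Matrix.of_apply, this, inner_sum_smul_gram]
    rfl
  have hgr : Matrix.gram ℝ (fun l => ∑ a, A l a • e a)
      = Matrix.of A * Matrix.gram ℝ e * (Matrix.of A).transpose :=
    gram_sum_smul e (Matrix.of A)
  simp only [hproj]
  rw [hgr, hB, Matrix.transpose_mul, Matrix.transpose_transpose, gram_transpose]
  conv_lhs => rw [← hG]
  simp only [Matrix.mul_assoc]

variable [Fintype n] [DecidableEq n]

theorem isUnit_det_gram_iff (x : n → H) :
    IsUnit (Matrix.gram ℝ x).det ↔ ∀ c : n → ℝ, ∑ k, c k • x k = 0 → c = 0 := by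
  constructor
  · intro h c hc
    have h0 : (Matrix.gram ℝ x).mulVec c = 0 := by
      funext l
      rw [← inner_sum_smul_gram, hc, inner_zero_right, Pi.zero_apply]
    have h1 := congrArg (Matrix.gram ℝ x)⁻¹.mulVec h0
    rwa [Matrix.mulVec_mulVec, Matrix.nonsing_inv_mul _ h, Matrix.one_mulVec,
      Matrix.mulVec_zero] at h1
  · intro h
    rw [isUnit_iff_ne_zero]
    intro hdet
    obtain ⟨c, hc0, hc⟩ := Matrix.exists_mulVec_eq_zero_iff.2 hdet
    refine hc0 (h c ?_)
    have := dotProduct_gram_mulVec x c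
    rw [hc, dotProduct_zero] at this
    simpa using this.symm

/-- If the projections of a family to a subspace are independent, so are those to a larger one. -/
theorem isUnit_det_gram_starProjection_mono {K L : Submodule ℝ H} [K.HasOrthogonalProjection]
    [L.HasOrthogonalProjection] (hKL : K ≤ L) (x : n → H)
    (h : IsUnit (Matrix.gram ℝ fun l => K.starProjection (x l)).det) :
    IsUnit (Matrix.gram ℝ fun l => L.starProjection (x l)).det := by
  rw [isUnit_det_gram_iff] at h ⊢
  intro c hc
  apply h c
  simp only [← map_smul, ← map_sum] at hc ⊢
  rw [← Submodule.starProjection_comp_starProjection_of_le hKL, ContinuousLinearMap.comp_apply,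
    hc, map_zero]

/-- A dense subspace `D` stays dense when intersected with a closed subspace of finite codimension:
a vector orthogonal to the intersection is, on `D`, a combination of the functionals that define
the subspace, hence it is such a combination on the whole space. -/
theorem orthogonal_span_le_closure_inf [CompleteSpace H] (D : Submodule ℝ H)
    (hD : Dense (D : Set H)) {κ : Type*} [Finite κ] (e : κ → H) :
    (Submodule.span ℝ (Set.range e))ᗮ
      ≤ (D ⊓ (Submodule.span ℝ (Set.range e))ᗮ).topologicalClosure := by
  have : Fintype κ := Fintype.ofFinite κ
  have hfin : FiniteDimensional ℝ (Submodule.span ℝ (Set.range e)) :=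
    FiniteDimensional.span_of_finite ℝ (Set.finite_range e)
  rw [← Submodule.orthogonal_orthogonal_eq_closure]
  refine Submodule.orthogonal_le fun x hx => ?_
  have hker : ⨅ a, ((innerSL ℝ (e a)).toLinearMap ∘ₗ D.subtype).ker
      ≤ ((innerSL ℝ x).toLinearMap ∘ₗ D.subtype).ker := by
    intro f hf
    simp only [Submodule.mem_iInf, LinearMap.mem_ker, LinearMap.comp_apply, Submodule.subtype_apply,
      ContinuousLinearMap.coe_coe, innerSL_apply_apply] at hf ⊢
    refine (Submodule.mem_orthogonal' _ _).1 hx _ ⟨f.2, ?_⟩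
    rw [SetLike.mem_coe, Submodule.mem_orthogonal]
    intro u hu
    induction hu using Submodule.span_induction with
    | mem u hu => obtain ⟨a, rfl⟩ := hu; exact hf a
    | zero => exact inner_zero_left _
    | add u v _ _ hu hv => rw [inner_add_left, hu, hv, add_zero]
    | smul c u _ hu => rw [inner_smul_left, hu, mul_zero]
  obtain ⟨c, hc⟩ := (Submodule.mem_span_range_iff_exists_fun ℝ).1 (mem_span_of_iInf_ker_le_ker hker)
  have hx0 : x - ∑ a, c a • e a = 0 := by
    refine hD.eq_zero_of_inner_left ℝ fun f hf => ?_
    have := DFunLike.congr_fun hc (⟨f, hf⟩ : D)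
    simp only [LinearMap.sum_apply, LinearMap.smul_apply, LinearMap.comp_apply,
      Submodule.subtype_apply, ContinuousLinearMap.coe_coe, innerSL_apply_apply] at this
    rw [inner_sub_left, sum_inner, ← this, sub_eq_zero]
    exact Finset.sum_congr rfl fun a _ => by rw [inner_smul_left, RCLike.conj_to_real, smul_eq_mul]
  rw [sub_eq_zero.1 hx0]
  exact Submodule.sum_mem _ fun a _ => Submodule.smul_mem _ _ (Submodule.subset_span ⟨a, rfl⟩)

end Hilbert

section Information

variable {q d : ℕ} {ι : Type*} {μ P₀ : Measure (Fin q → ℝ)} {θ₀ : Fin d → ℝ}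
  {M : Set ((Fin d → ℝ) × Measure (Fin q → ℝ))} {m : ι → (Fin q → ℝ) → (Fin d → ℝ) → ℝ}

/-- If the scores of all submodels are known up to the nuisance directions `Kᗮ`, and all nuisance
directions lie in the tangent space, then the efficient score is the projection to `K` of the score
for `θ`, and its variance matrix is the information. -/
theorem isInformation_gram_starProjection {K : Submodule ℝ (Lp ℝ 2 P₀)} [K.HasOrthogonalProjection]
    (S : (Fin d → ℝ) →L[ℝ] Lp ℝ 2 P₀) (h1 : ∀ v, IsTangent μ P₀ θ₀ M m v (S v))
    (h2 : ∀ v s, IsTangent μ P₀ θ₀ M m v s → s - S v ∈ Kᗮ)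
    (h3 : Kᗮ ≤ tangentSpace μ P₀ θ₀ M m)
    (h4 : IsUnit (Matrix.gram ℝ fun l => K.starProjection (S (Pi.single l 1))).det) :
    IsInformation μ P₀ θ₀ M m (Matrix.gram ℝ fun l => K.starProjection (S (Pi.single l 1))) := by
  set Φ : Fin d → Lp ℝ 2 P₀ := fun l => K.starProjection (S (Pi.single l 1)) with hΦ
  set I := Matrix.gram ℝ Φ with hI
  have hΦT : ∀ l, Φ l ∈ tangentSpace μ P₀ θ₀ M m := fun l => by
    have e : Φ l = S (Pi.single l 1) - (S (Pi.single l 1) - Φ l) := by abel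
    rw [e]
    refine Submodule.sub_mem _ ?_ (h3 (Submodule.sub_starProjection_mem_orthogonal _))
    exact Submodule.le_topologicalClosure _ (Submodule.subset_span ⟨_, h1 _⟩)
  have hΦs : ∀ v s, IsTangent μ P₀ θ₀ M m v s → ∀ l, inner ℝ (Φ l) s = I.mulVec v l := by
    intro v s hs l
    have e1 : inner ℝ (Φ l) (s - S v) = 0 :=
      (Submodule.mem_orthogonal _ _).1 (h2 v s hs) _ (Submodule.starProjection_apply_mem _ _)
    rw [inner_sub_right, sub_eq_zero] at e1
    have e2 : inner ℝ (Φ l) (S v - K.starProjection (S v)) = 0 :=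
      (Submodule.mem_orthogonal _ _).1 (Submodule.sub_starProjection_mem_orthogonal _) _
        (Submodule.starProjection_apply_mem _ _)
    rw [inner_sub_right, sub_eq_zero] at e2
    have e3 : K.starProjection (S v) = ∑ k, v k • Φ k := by
      conv_lhs => rw [pi_eq_sum_univ' v]
      simp only [map_sum, map_smul, hΦ]
    rw [e1, e2, e3, inner_sum_smul_gram]
  have hdet : IsUnit (I⁻¹).det := Matrix.isUnit_nonsing_inv_det _ h4
  have hgram : Matrix.gram ℝ (fun l => ∑ k, I⁻¹ l k • Φ k) = I⁻¹ := by
    rw [gram_sum_smul, ← hI, Matrix.nonsing_inv_mul _ h4, one_mul, Matrix.transpose_nonsing_inv,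
      gram_transpose]
  refine ⟨fun l => ∑ k, I⁻¹ l k • Φ k, ⟨fun l => ?_, fun v s hs l => ?_⟩, ?_, ?_⟩
  · exact Submodule.sum_mem _ fun k _ => Submodule.smul_mem _ _ (hΦT k)
  · simp only [sum_inner, inner_smul_left, RCLike.conj_to_real, hΦs v s hs]
    change (I⁻¹.mulVec (I.mulVec v)) l = v l
    rw [Matrix.mulVec_mulVec, Matrix.nonsing_inv_mul _ h4, Matrix.one_mulVec]
  · rw [hgram]; exact hdet
  · rw [hgram, Matrix.nonsing_inv_nonsing_inv _ h4]

end Information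

/-! ### The information in a model of unconditional moment equations -/

section Unconditional

variable {q d : ℕ} {ι : Type*} {μ P₀ : Measure (Fin q → ℝ)} {Θ : Set (Fin d → ℝ)}
  {θ₀ : Fin d → ℝ} {m : ι → (Fin q → ℝ) → (Fin d → ℝ) → ℝ}

/-- The essentially bounded functions, as a subspace of `L²(P₀)`. -/
def boundedLp (P₀ : Measure (Fin q → ℝ)) : Submodule ℝ (Lp ℝ 2 P₀) where
  carrier := {f | ∃ C : ℝ, ∀ᵐ z ∂P₀, |f z| ≤ C}
  add_mem' := by
    rintro f g ⟨C, hC⟩ ⟨C', hC'⟩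
    refine ⟨C + C', ?_⟩
    filter_upwards [hC, hC', Lp.coeFn_add f g] with z h1 h2 h3
    rw [h3, Pi.add_apply]
    exact (abs_add_le _ _).trans (add_le_add h1 h2)
  zero_mem' := by
    refine ⟨0, ?_⟩
    filter_upwards [Lp.coeFn_zero ℝ 2 P₀] with z hz
    change |(0 : Lp ℝ 2 P₀) z| ≤ 0
    rw [hz, Pi.zero_apply, abs_zero]
  smul_mem' := by
    rintro c f ⟨C, hC⟩
    refine ⟨|c| * C, ?_⟩
    filter_upwards [hC, Lp.coeFn_smul c f] with z h1 h2
    rw [h2, Pi.smul_apply, smul_eq_mul, abs_mul]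
    exact mul_le_mul_of_nonneg_left h1 (abs_nonneg _)

theorem toLp_mem_boundedLp {f : (Fin q → ℝ) → ℝ} (hf : MemLp f 2 P₀) {C : ℝ}
    (hC : ∀ᵐ z ∂P₀, |f z| ≤ C) : hf.toLp f ∈ boundedLp P₀ := by
  refine ⟨C, ?_⟩
  filter_upwards [hC, hf.coeFn_toLp] with z h1 h2
  rwa [h2]

theorem dense_boundedLp : Dense (boundedLp P₀ : Set (Lp ℝ 2 P₀)) := by
  intro f
  rw [Metric.mem_closure_iff]
  intro ε hε
  obtain ⟨g, hg, hg2⟩ := (Lp.memLp f).exists_simpleFunc_eLpNorm_sub_lt (by norm_num)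
    (ε := ENNReal.ofReal ε) (by rwa [ne_eq, ENNReal.ofReal_eq_zero, not_le])
  obtain ⟨C, hC⟩ := g.exists_forall_norm_le
  refine ⟨hg2.toLp g, toLp_mem_boundedLp hg2 (C := C) (Eventually.of_forall hC), ?_⟩
  rw [dist_eq_norm, Lp.norm_def, eLpNorm_congr_ae (g := (f : (Fin q → ℝ) → ℝ) - ⇑g)]
  · exact ENNReal.toReal_lt_of_lt_ofReal hg
  · filter_upwards [Lp.coeFn_sub f (hg2.toLp g), hg2.coeFn_toLp] with z h1 h2
    rw [h1, Pi.sub_apply, Pi.sub_apply, h2]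

/-- The span in `L²(P₀)` of the constants and a family of functions. The constants are included
since all scores have mean zero. -/
noncomputable def oneSpan (P₀ : Measure (Fin q → ℝ)) [IsFiniteMeasure P₀] (e : ι → Lp ℝ 2 P₀) :
    Submodule ℝ (Lp ℝ 2 P₀) :=
  Submodule.span ℝ (insert (oneLp P₀) (Set.range e))

theorem mem_orthogonal_oneSpan [IsFiniteMeasure P₀] {e : ι → Lp ℝ 2 P₀} {h : Lp ℝ 2 P₀} :
    h ∈ (oneSpan P₀ e)ᗮ ↔ inner ℝ (oneLp P₀) h = 0 ∧ ∀ a, inner ℝ (e a) h = 0 := by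
  rw [Submodule.mem_orthogonal]
  refine ⟨fun H => ⟨H _ (Submodule.subset_span (Set.mem_insert _ _)), fun a =>
    H _ (Submodule.subset_span (Set.mem_insert_of_mem _ ⟨a, rfl⟩))⟩, fun H u hu => ?_⟩
  induction hu using Submodule.span_induction with
  | mem u hu =>
    rcases hu with rfl | ⟨a, rfl⟩
    · exact H.1
    · exact H.2 a
  | zero => exact inner_zero_left _
  | add u v _ _ hu hv => rw [inner_add_left, hu, hv, add_zero]
  | smul c u _ hu => rw [inner_smul_left, hu, mul_zero]

instance finiteDimensional_oneSpan [IsFiniteMeasure P₀] [Finite ι] (e : ι → Lp ℝ 2 P₀) :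
    FiniteDimensional ℝ (oneSpan P₀ e) :=
  FiniteDimensional.span_of_finite ℝ ((Set.finite_range e).insert _)

theorem orthogonal_oneSpan_le_closure [IsFiniteMeasure P₀] [Finite ι] (e : ι → Lp ℝ 2 P₀) :
    (oneSpan P₀ e)ᗮ ≤ (boundedLp P₀ ⊓ (oneSpan P₀ e)ᗮ).topologicalClosure := by
  have hr : Set.range (fun a : Option ι => a.elim (oneLp P₀) e)
      = insert (oneLp P₀) (Set.range e) := by
    ext x
    simp [Option.exists, eq_comm]
  have := orthogonal_span_le_closure_inf (boundedLp P₀) dense_boundedLp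
    (fun a : Option ι => a.elim (oneLp P₀) e)
  rwa [hr] at this

/-- Moment functions at `θ₀`, as elements of `L²(P₀)`. -/
noncomputable def momentLp (hm : ∀ a, MemLp (fun z => m a z θ₀) 2 P₀) (a : ι) : Lp ℝ 2 P₀ :=
  (hm a).toLp _

theorem momentVariance_eq (hP : (θ₀, P₀) ∈ unconditionalModel μ Θ m)
    (hm : ∀ a, MemLp (fun z => m a z θ₀) 2 P₀) :
    momentVariance P₀ θ₀ m = Matrix.gram ℝ (momentLp hm) := by
  ext a b
  rw [momentVariance, Matrix.of_apply, ProbabilityTheory.covariance, (hP.2.2.2 a).2,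
    (hP.2.2.2 b).2, Matrix.gram_apply, momentLp, inner_toLp_left]
  refine integral_congr_ae ?_
  filter_upwards [(hm b).coeFn_toLp] with z hz
  simp only [momentLp, hz, sub_zero]

variable [SigmaFinite μ] [IsProbabilityMeasure P₀]
  {Q : (Fin d → ℝ) → Measure (Fin q → ℝ)} {S : (Fin d → ℝ) →L[ℝ] Lp ℝ 2 P₀}

theorem jacobian_eq
    (h : IsRegularSubmodel μ P₀ θ₀ (unconditionalModel μ Θ m) m (fun u => θ₀ + u) Q
      (ContinuousLinearMap.id ℝ (Fin d → ℝ)) S)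
    (hm : ∀ a θ, Measurable fun z => m a z θ) :
    jacobian P₀ θ₀ m = -Matrix.of fun a l =>
      inner ℝ (momentLp (h.memLp hm) a) (S (Pi.single l 1)) := by
  ext a l
  rw [jacobian, Matrix.of_apply, (h.hasFDerivAt_moment_theta hm a).fderiv]
  rfl

/-- The matrix `E[∂m]' V⁻ E[∂m]` is the variance matrix of the projection of the score for `θ` to
the span of the constants and the moment functions. -/
theorem momentInformation_eq_gram [Fintype ι]
    (h : IsRegularSubmodel μ P₀ θ₀ (unconditionalModel μ Θ m) m (fun u => θ₀ + u) Q
      (ContinuousLinearMap.id ℝ (Fin d → ℝ)) S)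
    (hP : (θ₀, P₀) ∈ unconditionalModel μ Θ m)
    (hm : ∀ a θ, Measurable fun z => m a z θ) {G : Matrix ι ι ℝ}
    (hG : IsGeneralizedInverse (momentVariance P₀ θ₀ m) G) :
    momentInformation P₀ θ₀ m G = Matrix.gram ℝ fun l =>
      (oneSpan P₀ (momentLp (h.memLp hm))).starProjection (S (Pi.single l 1)) := by
  rw [momentVariance_eq hP (h.memLp hm)] at hG
  have hfin : FiniteDimensional ℝ (Submodule.span ℝ
      (insert (oneLp P₀) (Set.range (momentLp (h.memLp hm))))) :=
    finiteDimensional_oneSpan (momentLp (h.memLp hm))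
  have := gram_starProjection_eq (o := oneLp P₀) (momentLp (h.memLp hm))
    (fun l : Fin d => S (Pi.single l 1)) (fun a => ?_)
    (fun l => h.inner_one_score (fun x hx => ⟨hx.2.1, hx.2.2.1⟩) _) hG
  · refine Eq.trans ?_ this.symm
    rw [momentInformation, jacobian_eq h hm, Matrix.transpose_neg, Matrix.neg_mul, Matrix.neg_mul,
      Matrix.mul_neg, neg_neg]
  · rw [real_inner_comm, momentLp, inner_toLp_left]
    have e : ∫ z, m a z θ₀ * (oneLp P₀ : Lp ℝ 2 P₀) z ∂P₀ = ∫ z, m a z θ₀ ∂P₀ := by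
      refine integral_congr_ae ?_
      filter_upwards [(memLp_const (μ := P₀) (p := 2) (1 : ℝ)).coeFn_toLp] with z hz
      rw [oneLp, hz, mul_one]
    rw [e, (hP.2.2.2 a).2]

theorem isInformation_unconditionalModel [Fintype ι]
    (h : IsRegularSubmodel μ P₀ θ₀ (unconditionalModel μ Θ m) m (fun u => θ₀ + u) Q
      (ContinuousLinearMap.id ℝ (Fin d → ℝ)) S)
    (hP : (θ₀, P₀) ∈ unconditionalModel μ Θ m)
    (hm : ∀ a θ, Measurable fun z => m a z θ) {G : Matrix ι ι ℝ}
    (hG : IsGeneralizedInverse (momentVariance P₀ θ₀ m) G)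
    (hns : IsUnit (momentInformation P₀ θ₀ m G).det) :
    IsInformation μ P₀ θ₀ (unconditionalModel μ Θ m) m (momentInformation P₀ θ₀ m G) := by
  rw [momentInformation_eq_gram h hP hm hG] at hns ⊢
  refine isInformation_gram_starProjection S h.isTangent ?_ ?_ hns
  · rintro v s ⟨ϑ, P, D, S', h', rfl, rfl⟩
    have hM : ∀ x ∈ unconditionalModel μ Θ m, IsProbabilityMeasure x.2 ∧ x.2 ≪ μ :=
      fun x hx => ⟨hx.2.1, hx.2.2.1⟩
    refine mem_orthogonal_oneSpan.2 ⟨?_, fun a => ?_⟩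
    · rw [inner_sub_right, h'.inner_one_score hM, h.inner_one_score hM, sub_zero]
    · rw [momentLp, inner_toLp_left]
      exact h.inner_moment_score_sub h' hm a
  · refine (orthogonal_oneSpan_le_closure _).trans
      (Submodule.topologicalClosure_mono fun f hf => ?_)
    obtain ⟨h1, h2⟩ := mem_orthogonal_oneSpan.1 hf.2
    refine Submodule.subset_span ⟨0, isTangent_unconditionalModel hP (h.memLp hm) f hf.1 ?_
      fun a => ?_⟩
    · rw [← inner_oneLp, h1]
    · rw [← h2 a, momentLp, inner_toLp_left]

end Unconditional

/-! ### Conditional moments with a bounded conditional variance -/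

section ConditionalTools

variable {Ω : Type*} {𝓖 m0 : MeasurableSpace Ω} {P : Measure Ω} [IsProbabilityMeasure P]
  {f : Ω → ℝ} {C : ℝ}

/-- If `E[f² | 𝓖] ≤ C`, then multiplication by `f` is bounded on the `𝓖`-measurable functions in
`L²`: on `𝓖`, the measure with density `f²` is at most `C` times `P`. -/
theorem lintegral_sq_mul_le (hle : 𝓖 ≤ m0) (hfm : Measurable f) (hf : MemLp f 2 P)
    (hC : ∀ᵐ z ∂P, (P[fun y => f y ^ 2 | 𝓖]) z ≤ C) (hC0 : 0 ≤ C) {φ : Ω → ℝ}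
    (hφ : StronglyMeasurable[𝓖] φ) :
    ∫⁻ z, ‖φ z * f z‖ₑ ^ (2 : ℝ) ∂P ≤ ENNReal.ofReal C * ∫⁻ z, ‖φ z‖ₑ ^ (2 : ℝ) ∂P := by
  have hd : Measurable fun z => ENNReal.ofReal (f z ^ 2) := by fun_prop
  have hint : Integrable (fun z => f z ^ 2) P := hf.integrable_sq
  have hν : (P.withDensity fun z => ENNReal.ofReal (f z ^ 2)).trim hle
      ≤ ENNReal.ofReal C • P.trim hle := by
    refine Measure.le_iff.2 fun B hB => ?_
    rw [Measure.smul_apply, trim_measurableSet_eq hle hB, trim_measurableSet_eq hle hB,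
      withDensity_apply _ (hle _ hB), smul_eq_mul,
      ← ofReal_integral_eq_lintegral_ofReal hint.integrableOn
        (Eventually.of_forall fun z => sq_nonneg _), ← setIntegral_condExp hle hint hB]
    have h1 : ∫ z in B, (P[fun y => f y ^ 2 | 𝓖]) z ∂P ≤ ∫ _ in B, C ∂P :=
      integral_mono_ae integrable_condExp.integrableOn (integrable_const C)
        (ae_restrict_of_ae hC)
    refine (ENNReal.ofReal_le_ofReal h1).trans (le_of_eq ?_)
    rw [setIntegral_const, smul_eq_mul, mul_comm, ENNReal.ofReal_mul hC0, measureReal_def,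
      ENNReal.ofReal_toReal (measure_ne_top _ _)]
  have hφ2 : Measurable[𝓖] fun z => ‖φ z‖ₑ ^ (2 : ℝ) := by
    have := hφ.measurable
    fun_prop
  calc ∫⁻ z, ‖φ z * f z‖ₑ ^ (2 : ℝ) ∂P
      = ∫⁻ z, ‖φ z‖ₑ ^ (2 : ℝ) ∂(P.withDensity fun z => ENNReal.ofReal (f z ^ 2)) := by
        rw [lintegral_withDensity_eq_lintegral_mul _ hd (hφ2.mono hle le_rfl)]
        refine lintegral_congr fun z => ?_
        rw [Pi.mul_apply, enorm_mul, ENNReal.mul_rpow_of_nonneg _ _ (by norm_num), mul_comm]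
        congr 1
        rw [← sq_abs, ← Real.norm_eq_abs, ENNReal.ofReal_pow (norm_nonneg _), ofReal_norm,
          ENNReal.rpow_two]
    _ = ∫⁻ z, ‖φ z‖ₑ ^ (2 : ℝ) ∂((P.withDensity fun z => ENNReal.ofReal (f z ^ 2)).trim hle) :=
        (lintegral_trim hle hφ2).symm
    _ ≤ ∫⁻ z, ‖φ z‖ₑ ^ (2 : ℝ) ∂(ENNReal.ofReal C • P.trim hle) := lintegral_mono' hν le_rfl
    _ = ENNReal.ofReal C * ∫⁻ z, ‖φ z‖ₑ ^ (2 : ℝ) ∂P := by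
        rw [lintegral_smul_measure, lintegral_trim hle hφ2, smul_eq_mul]

theorem memLp_mul_of_condExp_sq_le (hle : 𝓖 ≤ m0) (hfm : Measurable f) (hf : MemLp f 2 P)
    (hC : ∀ᵐ z ∂P, (P[fun y => f y ^ 2 | 𝓖]) z ≤ C) {φ : Ω → ℝ}
    (hφ : StronglyMeasurable[𝓖] φ) (hφ2 : MemLp φ 2 P) :
    MemLp (fun z => φ z * f z) 2 P ∧ (eLpNorm (fun z => φ z * f z) 2 P).toReal
      ≤ √(max C 0) * (eLpNorm φ 2 P).toReal := by
  have hle2 : eLpNorm (fun z => φ z * f z) 2 P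
      ≤ ENNReal.ofReal (√(max C 0)) * eLpNorm φ 2 P := by
    have h1 := lintegral_sq_mul_le hle hfm hf (hC.mono fun z hz => hz.trans (le_max_left C 0))
      (le_max_right _ _) hφ
    rw [eLpNorm_eq_lintegral_rpow_enorm_toReal (by norm_num) (by norm_num),
      eLpNorm_eq_lintegral_rpow_enorm_toReal (by norm_num) (by norm_num)]
    simp only [ENNReal.toReal_ofNat]
    refine (ENNReal.rpow_le_rpow h1 (by norm_num)).trans (le_of_eq ?_)
    rw [ENNReal.mul_rpow_of_nonneg _ _ (by norm_num), Real.sqrt_eq_rpow,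
      ENNReal.ofReal_rpow_of_nonneg (le_max_right _ _) (by norm_num)]
  have htop : ENNReal.ofReal (√(max C 0)) * eLpNorm φ 2 P ≠ ∞ :=
    ENNReal.mul_ne_top ENNReal.ofReal_ne_top hφ2.2.ne
  refine ⟨⟨((hφ.mono hle).measurable.mul hfm).aestronglyMeasurable,
    hle2.trans_lt htop.lt_top⟩, ?_⟩
  refine (ENNReal.toReal_mono htop hle2).trans (le_of_eq ?_)
  rw [ENNReal.toReal_mul, ENNReal.toReal_ofReal (Real.sqrt_nonneg _)]

theorem condExp_ae_eq_zero (hle : 𝓖 ≤ m0) {u : Ω → ℝ} (hu : Integrable u P)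
    (h : ∀ B, MeasurableSet[𝓖] B → ∫ z in B, u z ∂P = 0) : P[u | 𝓖] =ᵐ[P] 0 := by
  refine (ae_eq_condExp_of_forall_setIntegral_eq hle hu (fun _ _ _ => integrableOn_zero)
    (fun B hB _ => ?_) aestronglyMeasurable_zero).symm
  simp [h B hB]

theorem integral_mul_eq_zero_of_condExp (hle : 𝓖 ≤ m0) {φ u : Ω → ℝ}
    (hφ : StronglyMeasurable[𝓖] φ) (hφu : Integrable (fun z => φ z * u z) P)
    (hu : Integrable u P) (h : P[u | 𝓖] =ᵐ[P] 0) : ∫ z, φ z * u z ∂P = 0 := by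
  rw [← integral_condExp hle]
  refine (integral_congr_ae ?_).trans (integral_zero Ω ℝ)
  filter_upwards [condExp_mul_of_stronglyMeasurable_left hφ hφu hu, h] with z h1 h2
  change (P[φ * u | 𝓖]) z = 0
  rw [h1, Pi.mul_apply, h2, Pi.zero_apply, mul_zero]

/-- If `h` is orthogonal to `E[w | 𝓖] f` for all `w` in a family with dense span in `L²`, then it is
orthogonal to `f` conditionally on `𝓖`. -/
theorem condExp_eq_zero_of_instruments (hle : 𝓖 ≤ m0) (hfm : Measurable f) (hf : MemLp f 2 P)
    (hC : ∀ᵐ z ∂P, (P[fun y => f y ^ 2 | 𝓖]) z ≤ C) {w : ℕ → Ω → ℝ} (hw : ∀ s, MemLp (w s) 2 P)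
    (hspan : (Submodule.span ℝ (Set.range fun s => (hw s).toLp (w s))).topologicalClosure = ⊤)
    {h : Ω → ℝ} (hh : MemLp h 2 P)
    (h0 : ∀ s, ∫ z, (P[w s | 𝓖]) z * f z * h z ∂P = 0) :
    P[fun z => f z * h z | 𝓖] =ᵐ[P] 0 := by
  have hcond : ∀ u : Ω → ℝ, MemLp u 2 P → MemLp (fun z => (P[u | 𝓖]) z * f z) 2 P ∧
      (eLpNorm (fun z => (P[u | 𝓖]) z * f z) 2 P).toReal
        ≤ √(max C 0) * (eLpNorm u 2 P).toReal := fun u hu => by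
    have h1 := memLp_mul_of_condExp_sq_le hle hfm hf hC stronglyMeasurable_condExp
      (hu.condExp (m := 𝓖) (by norm_num))
    refine ⟨h1.1, h1.2.trans (mul_le_mul_of_nonneg_left ?_ (Real.sqrt_nonneg _))⟩
    exact ENNReal.toReal_mono hu.2.ne (eLpNorm_condExp_le_eLpNorm u (by norm_num))
  -- the continuous linear functional `u ↦ E[E[u | 𝓖] f h]`
  let L₀ : Lp ℝ 2 P →ₗ[ℝ] ℝ :=
    { toFun := fun u => ∫ z, (P[u | 𝓖]) z * f z * h z ∂P
      map_add' := fun u v => by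
        refine Eq.trans (integral_congr_ae ?_) (integral_add
          ((hcond u (Lp.memLp u)).1.integrable_mul hh) ((hcond v (Lp.memLp v)).1.integrable_mul hh))
        filter_upwards [condExp_congr_ae (m := 𝓖) (Lp.coeFn_add u v),
          condExp_add ((Lp.memLp u).integrable (by norm_num))
            ((Lp.memLp v).integrable (by norm_num)) 𝓖] with z h1 h2
        rw [h1, h2, Pi.add_apply]
        ring
      map_smul' := fun c u => by
        rw [RingHom.id_apply, smul_eq_mul, ← integral_const_mul]
        refine integral_congr_ae ?_
        filter_upwards [condExp_congr_ae (m := 𝓖) (Lp.coeFn_smul c u),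
          condExp_smul c (u : Ω → ℝ) 𝓖] with z h1 h2
        rw [h1, h2, Pi.smul_apply, smul_eq_mul]
        ring }
  let L : Lp ℝ 2 P →L[ℝ] ℝ := L₀.mkContinuous (√(max C 0) * (eLpNorm h 2 P).toReal) fun u => by
    refine (abs_integral_mul_le (hcond u (Lp.memLp u)).1 hh).trans ?_
    rw [Lp.norm_def, mul_right_comm]
    exact mul_le_mul_of_nonneg_right (hcond u (Lp.memLp u)).2 ENNReal.toReal_nonneg
  have hcongr : ∀ (u : Ω → ℝ) (hu : MemLp u 2 P),
      L (hu.toLp u) = ∫ z, (P[u | 𝓖]) z * f z * h z ∂P := fun u hu => by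
    refine integral_congr_ae ?_
    filter_upwards [condExp_congr_ae (m := 𝓖) hu.coeFn_toLp] with z h1
    rw [h1]
  have hker : L.ker = ⊤ := by
    refine top_le_iff.1 (hspan ▸ Submodule.topologicalClosure_minimal _ ?_ L.isClosed_ker)
    refine Submodule.span_le.2 ?_
    rintro _ ⟨s, rfl⟩
    exact (hcongr _ _).trans (h0 s)
  refine condExp_ae_eq_zero hle (hf.integrable_mul hh) fun B hB => ?_
  have hind : MemLp (B.indicator fun _ => (1 : ℝ)) 2 P := (memLp_const 1).indicator (hle _ hB)
  have h1 : L (hind.toLp _) = 0 := by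
    have : hind.toLp _ ∈ L.ker := by rw [hker]; trivial
    exact this
  rw [hcongr, condExp_of_stronglyMeasurable hle
    ((@stronglyMeasurable_const _ _ 𝓖 _ _).indicator hB) (hind.integrable (by norm_num))] at h1
  rw [← h1, ← integral_indicator (hle _ hB)]
  congr 1
  funext z
  by_cases hz : z ∈ B <;> simp [hz]

/-- With a bounded conditional variance, `E[f u | 𝓖]` is bounded for bounded `u`. -/
theorem exists_bound_condExp_mul {u : Ω → ℝ}
    (hf : MemLp f 2 P) {K : ℝ}
    (hC : ∀ᵐ z ∂P, (P[fun y => f y ^ 2 | 𝓖]) z ≤ C) (hu : AEStronglyMeasurable u P)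
    (hK : ∀ᵐ z ∂P, |u z| ≤ K) : ∃ B : ℝ, ∀ᵐ z ∂P, |(P[fun z => f z * u z | 𝓖]) z| ≤ B := by
  have hfu : Integrable (fun z => f z * u z) P :=
    (hf.integrable (by norm_num)).mul_bdd (c := K) hu hK
  have hsq : Integrable (fun z => f z ^ 2) P := hf.integrable_sq
  have hmaj : Integrable ((fun _ : Ω => K) + K • fun z => f z ^ 2) P :=
    (integrable_const K).add (hsq.smul K)
  have hb : ∀ᵐ z ∂P, |f z * u z| ≤ ((fun _ : Ω => K) + K • fun z => f z ^ 2) z := by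
    filter_upwards [hK] with z hz
    rw [abs_mul, Pi.add_apply, Pi.smul_apply, smul_eq_mul]
    have h1 : |f z| ≤ 1 + f z ^ 2 := by
      rw [← sq_abs]
      nlinarith [sq_nonneg (|f z| - 1), abs_nonneg (f z)]
    have hK0 := (abs_nonneg _).trans hz
    nlinarith [abs_nonneg (f z), abs_nonneg (u z)]
  by_cases hm : 𝓖 ≤ m0
  · have h1 := condExp_mono (m := 𝓖) hfu hmaj (hb.mono fun z hz => (le_abs_self _).trans hz)
    have h2 := condExp_mono (m := 𝓖) hfu.neg hmaj (hb.mono fun z hz => (neg_le_abs _).trans hz)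
    have h3 := condExp_neg (μ := P) (fun z => f z * u z) 𝓖
    have h4 := condExp_add (integrable_const K) (hsq.smul K) 𝓖
    have h5 := condExp_smul (μ := P) K (fun z => f z ^ 2) 𝓖
    refine ⟨K + K * C, ?_⟩
    filter_upwards [h1, h2, h3, h4, h5, hC, hK] with z h1 h2 h3 h4 h5 h6 h7
    have hK0 := (abs_nonneg _).trans h7
    rw [h4, Pi.add_apply, h5, condExp_const hm, Pi.smul_apply, smul_eq_mul] at h1 h2
    rw [h3, Pi.neg_apply] at h2
    have h8 := mul_le_mul_of_nonneg_left h6 hK0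
    rw [abs_le]
    constructor <;> linarith
  · exact ⟨0, Eventually.of_forall fun z => by simp [condExp_of_not_le hm]⟩

/-- If `h` is orthogonal to `f` conditionally on `𝓖`, then `E[f u | 𝓖]` is small in mean square for
`u` close to `h`. -/
theorem eLpNorm_condExp_mul_le (hle : 𝓖 ≤ m0) (hfm : Measurable f) (hf : MemLp f 2 P) {B : ℝ}
    (hC : ∀ᵐ z ∂P, (P[fun y => f y ^ 2 | 𝓖]) z ≤ C) (u h : Lp ℝ 2 P)
    (hB : ∀ᵐ z ∂P, |(P[fun z => f z * u z | 𝓖]) z| ≤ B)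
    (hh : P[fun z => f z * h z | 𝓖] =ᵐ[P] 0) :
    MemLp (P[fun z => f z * u z | 𝓖]) 2 P ∧
      (eLpNorm (P[fun z => f z * u z | 𝓖]) 2 P).toReal ≤ √(max C 0) * ‖u - h‖ := by
  set r := P[fun z => f z * u z | 𝓖] with hr
  have hrm : StronglyMeasurable[𝓖] r := stronglyMeasurable_condExp
  have hrae : AEStronglyMeasurable r P := (hrm.mono hle).aestronglyMeasurable
  have hr2 : MemLp r 2 P := MemLp.of_bound hrae B hB
  have hfu : Integrable (fun z => f z * u z) P := hf.integrable_mul (Lp.memLp u)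
  have hfh : Integrable (fun z => f z * h z) P := hf.integrable_mul (Lp.memLp h)
  have hrfu : Integrable (fun z => r z * (f z * u z)) P := hfu.bdd_mul hrae hB
  have hrfh : Integrable (fun z => r z * (f z * h z)) P := hfh.bdd_mul hrae hB
  obtain ⟨hrf, hrf'⟩ := memLp_mul_of_condExp_sq_le hle hfm hf hC hrm hr2
  have e1 : ∫ z, r z * r z ∂P = ∫ z, r z * (f z * u z) ∂P := by
    rw [← integral_condExp hle (f := fun z => r z * (f z * u z))]
    refine integral_congr_ae ?_
    filter_upwards [condExp_mul_of_stronglyMeasurable_left hrm hrfu hfu] with z hz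
    exact hz.symm
  have e2 : ∫ z, r z * (f z * u z) ∂P = ∫ z, r z * f z * (u - h : Lp ℝ 2 P) z ∂P := by
    have h0 := integral_mul_eq_zero_of_condExp hle hrm hrfh hfh hh
    rw [← sub_zero (∫ z, r z * (f z * u z) ∂P), ← h0, ← integral_sub hrfu hrfh]
    refine integral_congr_ae ?_
    filter_upwards [Lp.coeFn_sub u h] with z hz
    rw [hz, Pi.sub_apply]
    ring
  have e3 : ∫ z, r z * r z ∂P = (eLpNorm r 2 P).toReal ^ 2 := by
    rw [← Lp.norm_toLp r hr2, ← real_inner_self_eq_norm_sq, inner_toLp_left]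
    refine integral_congr_ae ?_
    filter_upwards [hr2.coeFn_toLp] with z hz
    rw [hz]
  have e4 := (le_abs_self _).trans (abs_integral_mul_le hrf (Lp.memLp (u - h)))
  rw [← e2, ← e1, e3, ← Lp.norm_def] at e4
  refine ⟨hr2, ?_⟩
  have h5 := e4.trans (mul_le_mul_of_nonneg_right hrf' (norm_nonneg _))
  rcases (ENNReal.toReal_nonneg (a := eLpNorm r 2 P)).eq_or_lt with h6 | h6
  · rw [← h6]
    positivity
  · refine le_of_mul_le_mul_right ?_ h6
    linarith

end ConditionalTools

/-! ### Density of the bounded nuisance scores -/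

section Density

variable {q : ℕ} {P₀ : Measure (Fin q → ℝ)} [IsProbabilityMeasure P₀] {κ : Type*}
  {𝓖 : κ → MeasurableSpace (Fin q → ℝ)} {f : κ → (Fin q → ℝ) → ℝ}

/-- The mean-zero functions that are orthogonal to each `f a` conditionally on `𝓖 a`: the scores
that leave the conditional moment restrictions unchanged. -/
def IsNuisance (P₀ : Measure (Fin q → ℝ)) (𝓖 : κ → MeasurableSpace (Fin q → ℝ))
    (f : κ → (Fin q → ℝ) → ℝ) (h : Lp ℝ 2 P₀) : Prop :=
  ∫ z, h z ∂P₀ = 0 ∧ ∀ a, P₀[fun z => f a z * h z | 𝓖 a] =ᵐ[P₀] 0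

/-- A bounded family `β` that is biorthogonal to the family `f` in the conditional sense: the
conditional moments of `φ β_a`, for `φ` measurable with respect to `𝓖 a`, can be prescribed one at a
time. -/
structure IsBiorthogonal [DecidableEq κ] (P₀ : Measure (Fin q → ℝ))
    (𝓖 : κ → MeasurableSpace (Fin q → ℝ)) (f β : κ → (Fin q → ℝ) → ℝ) : Prop where
  measurable : ∀ a, AEStronglyMeasurable (β a) P₀
  bounded : ∀ a, ∃ C : ℝ, ∀ᵐ z ∂P₀, |β a z| ≤ C
  condExp : ∀ a b (φ : (Fin q → ℝ) → ℝ), StronglyMeasurable[𝓖 a] φ →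
    (∃ C : ℝ, ∀ᵐ z ∂P₀, |φ z| ≤ C) →
    P₀[fun z => φ z * β a z * f b z | 𝓖 b] =ᵐ[P₀] if a = b then φ else 0

theorem norm_oneLp : ‖oneLp P₀‖ = 1 := by
  rw [oneLp, Lp.norm_toLp, eLpNorm_const _ (by norm_num) (IsProbabilityMeasure.ne_zero _)]
  simp

theorem coeFn_oneLp : oneLp P₀ =ᵐ[P₀] fun _ => 1 := (memLp_const (1 : ℝ)).coeFn_toLp

theorem oneLp_mem_boundedLp : oneLp P₀ ∈ boundedLp P₀ :=
  toLp_mem_boundedLp _ (C := 1) (by simp)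

/-- A nuisance score is a limit of bounded ones. A bounded approximation `u` violates the
conditional restrictions by the small bounded functions `E[f_a u | 𝓖 a]`; the biorthogonal
family corrects all these errors at once, at a cost controlled by their size. -/
theorem IsNuisance.mem_closure [Fintype κ] [DecidableEq κ] (hle : ∀ a, 𝓖 a ≤ MeasurableSpace.pi)
    (hfm : ∀ a, Measurable (f a)) (hf : ∀ a, MemLp (f a) 2 P₀)
    (hf0 : ∀ a, P₀[f a | 𝓖 a] =ᵐ[P₀] 0)
    (hC : ∀ a, ∃ C : ℝ, ∀ᵐ z ∂P₀, (P₀[fun y => f a y ^ 2 | 𝓖 a]) z ≤ C)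
    {β : κ → (Fin q → ℝ) → ℝ} (hβ : IsBiorthogonal P₀ 𝓖 f β) {h : Lp ℝ 2 P₀}
    (hh : IsNuisance P₀ 𝓖 f h) :
    h ∈ closure {v | v ∈ boundedLp P₀ ∧ IsNuisance P₀ 𝓖 f v} := by
  choose C hC using hC
  choose B hB using hβ.bounded
  have hB0 : ∀ a, 0 ≤ B a := fun a => by
    obtain ⟨z, hz⟩ := (hB a).exists
    exact (abs_nonneg _).trans hz
  set T : ℝ := ∑ a, B a * √(max (C a) 0) with hT
  have hT0 : 0 ≤ T := Finset.sum_nonneg fun a _ => mul_nonneg (hB0 a) (Real.sqrt_nonneg _)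
  rw [Metric.mem_closure_iff]
  intro ε hε
  obtain ⟨u, hub, hu⟩ := Metric.mem_closure_iff.1 (dense_boundedLp h) (ε / (2 * (1 + T)))
    (by positivity)
  obtain ⟨K, hK⟩ := hub
  set r : κ → (Fin q → ℝ) → ℝ := fun a => P₀[fun z => f a z * u z | 𝓖 a] with hr
  have hrb : ∀ a, ∃ R : ℝ, ∀ᵐ z ∂P₀, |r a z| ≤ R := fun a =>
    exists_bound_condExp_mul (hf a) (hC a) (Lp.memLp u).1 hK
  have hr2 : ∀ a, MemLp (r a) 2 P₀ ∧
      (eLpNorm (r a) 2 P₀).toReal ≤ √(max (C a) 0) * ‖u - h‖ := fun a => by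
    obtain ⟨R, hR⟩ := hrb a
    exact eLpNorm_condExp_mul_le (hle a) (hfm a) (hf a) (hC a) u h hR (hh.2 a)
  have hrm : ∀ a, StronglyMeasurable[𝓖 a] (r a) := fun a => stronglyMeasurable_condExp
  have hcle : ∀ a, ∀ᵐ z ∂P₀, ‖r a z * β a z‖ ≤ B a * ‖r a z‖ := fun a => by
    filter_upwards [hB a] with z hz
    rw [norm_mul, mul_comm]
    exact mul_le_mul_of_nonneg_right hz (norm_nonneg _)
  have hc2 : ∀ a, MemLp (fun z => r a z * β a z) 2 P₀ := fun a =>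
    MemLp.of_le_mul (hr2 a).1 ((hr2 a).1.1.mul (hβ.measurable a)) (hcle a)
  have hcn : ∀ a, ‖(hc2 a).toLp _‖ ≤ B a * √(max (C a) 0) * ‖u - h‖ := fun a => by
    rw [Lp.norm_toLp, mul_assoc]
    have h1 := eLpNorm_le_mul_eLpNorm_of_ae_le_mul (hcle a) 2
    have h2 := ENNReal.toReal_mono (ENNReal.mul_ne_top ENNReal.ofReal_ne_top (hr2 a).1.2.ne) h1
    rw [ENNReal.toReal_mul, ENNReal.toReal_ofReal (hB0 a)] at h2
    exact h2.trans (mul_le_mul_of_nonneg_left (hr2 a).2 (hB0 a))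
  set c : Lp ℝ 2 P₀ := ∑ a, (hc2 a).toLp _ with hc
  have hcb : c ∈ boundedLp P₀ := Submodule.sum_mem _ fun a _ => by
    obtain ⟨R, hR⟩ := hrb a
    refine toLp_mem_boundedLp _ (C := B a * R) ?_
    filter_upwards [hcle a, hR] with z h1 h2
    exact h1.trans (mul_le_mul_of_nonneg_left h2 (hB0 a))
  have hcnorm : ‖c‖ ≤ T * ‖u - h‖ := by
    rw [hT, Finset.sum_mul]
    exact (norm_sum_le _ _).trans (Finset.sum_le_sum fun a _ => hcn a)
  set k : ℝ := inner ℝ (oneLp P₀) (u - c) with hk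
  set v : Lp ℝ 2 P₀ := u - c - k • oneLp P₀ with hv
  have hkle : |k| ≤ ‖u - h‖ + ‖c‖ := by
    have h0 : inner ℝ (oneLp P₀) h = 0 := by rw [inner_oneLp, hh.1]
    have h1 : k = inner ℝ (oneLp P₀) (u - h - c) := by
      rw [hk, inner_sub_right, inner_sub_right, inner_sub_right, h0, sub_zero]
    rw [h1]
    refine (abs_real_inner_le_norm _ _).trans ?_
    rw [norm_oneLp, one_mul]
    exact norm_sub_le _ _
  refine ⟨v, ⟨?_, ?_, fun b => ?_⟩, ?_⟩
  · exact Submodule.sub_mem _ (Submodule.sub_mem _ ⟨K, hK⟩ hcb)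
      (Submodule.smul_mem _ _ oneLp_mem_boundedLp)
  · rw [← inner_oneLp, hv, inner_sub_right, inner_smul_right, real_inner_self_eq_norm_sq,
      norm_oneLp, ← hk]
    ring
  · have hcoe : (fun z => f b z * v z) =ᵐ[P₀]
        (fun z => f b z * u z) - (∑ a, fun z => r a z * β a z * f b z) - k • f b := by
      have hcc : c =ᵐ[P₀] ∑ a, fun z => r a z * β a z := by
        rw [hc]
        filter_upwards [Lp.coeFn_finsetSum Finset.univ fun a => (hc2 a).toLp _,
          ae_all_iff.2 fun a => (hc2 a).coeFn_toLp] with z h1 h2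
        rw [h1, Finset.sum_apply, Finset.sum_apply]
        exact Finset.sum_congr rfl fun a _ => h2 a
      filter_upwards [Lp.coeFn_sub (u - c) (k • oneLp P₀), Lp.coeFn_sub u c, hcc,
        Lp.coeFn_smul k (oneLp P₀), coeFn_oneLp (P₀ := P₀)] with z h1 h2 h3 h4 h5
      rw [hv, h1, Pi.sub_apply, h2, Pi.sub_apply, h3, h4, Pi.smul_apply, h5]
      simp only [Pi.sub_apply, Finset.sum_apply, Pi.smul_apply, smul_eq_mul, mul_one,
        ← Finset.sum_mul]
      ring
    have hint1 : Integrable (fun z => f b z * u z) P₀ := (hf b).integrable_mul (Lp.memLp u)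
    have hint2 : ∀ a, Integrable (fun z => r a z * β a z * f b z) P₀ := fun a =>
      (hc2 a).integrable_mul (hf b)
    have hint3 : Integrable (f b) P₀ := (hf b).integrable (by norm_num)
    have hsum : P₀[∑ a, fun z => r a z * β a z * f b z | 𝓖 b] =ᵐ[P₀] r b := by
      refine (condExp_finsetSum (fun a _ => hint2 a) _).trans ?_
      have h1 : ∀ᵐ z ∂P₀, ∀ a, (P₀[fun z => r a z * β a z * f b z | 𝓖 b]) z
          = (if a = b then r a else 0) z :=
        ae_all_iff.2 fun a => hβ.condExp a b (r a) (hrm a) (hrb a)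
      filter_upwards [h1] with z hz
      rw [Finset.sum_apply, Finset.sum_congr rfl fun a _ => hz a,
        Finset.sum_eq_single b (fun a _ hab => by simp [hab]) (by simp)]
      simp
    filter_upwards [condExp_congr_ae (m := 𝓖 b) hcoe,
      condExp_sub (hint1.sub (integrable_finsetSum' _ fun a _ => hint2 a)) (hint3.smul k) (𝓖 b),
      condExp_sub hint1 (integrable_finsetSum' _ fun a _ => hint2 a) (𝓖 b),
      condExp_smul k (f b) (𝓖 b), hf0 b, hsum] with z h1 h2 h3 h4 h5 h6
    rw [h1, h2, Pi.sub_apply, h3, Pi.sub_apply, h4, Pi.smul_apply, h5, h6]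
    simp [hr]
  · have hd : dist h u = ‖u - h‖ := by rw [dist_comm, dist_eq_norm]
    rw [hd] at hu
    have h1 : h - v = -(u - h) + c + k • oneLp P₀ := by rw [hv]; abel
    rw [dist_eq_norm, h1]
    have h2 : ‖-(u - h) + c + k • oneLp P₀‖ ≤ ‖u - h‖ + ‖c‖ + |k| := by
      refine (norm_add_le _ _).trans (add_le_add ((norm_add_le _ _).trans ?_) ?_)
      · rw [norm_neg]
      · rw [norm_smul, norm_oneLp, mul_one, Real.norm_eq_abs]
    have h3 : ‖u - h‖ * (2 * (1 + T)) < ε := (lt_div_iff₀ (by positivity)).1 hu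
    nlinarith

end Density

/-! ### The biorthogonal family -/

section EssBounded

variable {Ω : Type*} {m0 : MeasurableSpace Ω} {P : Measure Ω} {f h : Ω → ℝ}

/-- An essentially bounded real function (measurability is not part of the notion). -/
def EssBounded (P : Measure Ω) (f : Ω → ℝ) : Prop :=
  ∃ C : ℝ, ∀ᵐ z ∂P, |f z| ≤ C

theorem EssBounded.sub (hf : EssBounded P f) (hh : EssBounded P h) :
    EssBounded P fun z => f z - h z := by
  obtain ⟨C, hC⟩ := hf
  obtain ⟨D, hD⟩ := hh
  refine ⟨C + D, ?_⟩
  filter_upwards [hC, hD] with z h1 h2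
  exact (abs_sub _ _).trans (add_le_add h1 h2)

theorem EssBounded.mul (hf : EssBounded P f) (hh : EssBounded P h) :
    EssBounded P fun z => f z * h z := by
  obtain ⟨C, hC⟩ := hf
  obtain ⟨D, hD⟩ := hh
  refine ⟨C * D, ?_⟩
  filter_upwards [hC, hD] with z h1 h2
  rw [abs_mul]
  exact mul_le_mul h1 h2 (abs_nonneg _) ((abs_nonneg _).trans h1)

theorem EssBounded.sum {ι : Type*} [Fintype ι] {f : ι → Ω → ℝ} (hf : ∀ i, EssBounded P (f i)) :
    EssBounded P fun z => ∑ i, f i z := by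
  choose C hC using hf
  refine ⟨∑ i, C i, ?_⟩
  filter_upwards [ae_all_iff.2 hC] with z hz
  exact (Finset.abs_sum_le_sum_abs _ _).trans (Finset.sum_le_sum fun i _ => hz i)

theorem EssBounded.condExp (𝓖 : MeasurableSpace Ω) (hf : EssBounded P f) :
    EssBounded P (P[f | 𝓖]) := by
  obtain ⟨C, hC⟩ := hf
  exact ⟨C, ae_bdd_norm_condExp_of_ae_bdd_norm (m := 𝓖) (μ := P) (f := f) (R := C) hC⟩

theorem EssBounded.memLp [IsFiniteMeasure P] (hf : EssBounded P f)
    (hfm : AEStronglyMeasurable f P) : MemLp f 2 P := by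
  obtain ⟨C, hC⟩ := hf
  exact MemLp.of_bound hfm C hC

theorem EssBounded.integrable_mul (hf : EssBounded P f) (hfm : AEStronglyMeasurable f P)
    (hh : Integrable h P) : Integrable (fun z => f z * h z) P := by
  obtain ⟨C, hC⟩ := hf
  exact hh.bdd_mul hfm hC

/-- The pull-out property given `𝓢`, followed by the tower property. -/
theorem condExp_mul_eq_zero [IsFiniteMeasure P] {𝓖 𝓢 : MeasurableSpace Ω} (h𝓖 : 𝓖 ≤ 𝓢)
    (h𝓢 : 𝓢 ≤ m0) (hf : StronglyMeasurable[𝓢] f) (hfb : EssBounded P f) (hh : Integrable h P)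
    (h0 : P[h | 𝓢] =ᵐ[P] 0) : P[fun z => f z * h z | 𝓖] =ᵐ[P] 0 := by
  have hfh : Integrable (fun z => f z * h z) P :=
    hfb.integrable_mul (hf.mono h𝓢).aestronglyMeasurable hh
  have h1 : P[fun z => f z * h z | 𝓢] =ᵐ[P] 0 := by
    filter_upwards [condExp_mul_of_stronglyMeasurable_left hf hfh hh, h0] with z h1 h2
    change (P[f * h | 𝓢]) z = 0
    rw [h1, Pi.mul_apply, h2, Pi.zero_apply, mul_zero]
  refine (condExp_condExp_of_le h𝓖 h𝓢).symm.trans ((condExp_congr_ae h1).trans ?_)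
  rw [condExp_zero]

end EssBounded

section MatrixMeasurability

variable {Ω ι κ : Type*} [mΩ : MeasurableSpace Ω] [Fintype ι] [DecidableEq ι]

theorem measurable_matrix_det {W : Ω → Matrix ι ι ℝ} (hW : ∀ a b, Measurable fun z => W z a b) :
    Measurable fun z => (W z).det := by
  simp only [Matrix.det_apply]
  refine Finset.measurable_sum _ fun τ _ => ?_
  exact (Finset.measurable_prod _ fun i _ => hW _ _).const_smul _

theorem measurable_matrix_inv_apply {W : Ω → Matrix ι ι ℝ}
    (hW : ∀ a b, Measurable fun z => W z a b) (a b : ι) :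
    Measurable fun z => (W z)⁻¹ a b := by
  simp only [Matrix.inv_def, Ring.inverse_eq_inv', Matrix.smul_apply, smul_eq_mul,
    Matrix.adjugate_apply]
  refine (measurable_matrix_det hW).inv.mul (measurable_matrix_det fun c e => ?_)
  simp only [Matrix.updateRow_apply]
  split_ifs
  · exact measurable_const
  · exact hW _ _

theorem measurable_matrix_mul_inv_apply {R : Ω → Matrix κ ι ℝ} {W : Ω → Matrix ι ι ℝ}
    (hR : ∀ a b, Measurable fun z => R z a b) (hW : ∀ a b, Measurable fun z => W z a b)
    (a : κ) (b : ι) : Measurable fun z => (R z * (W z)⁻¹) a b := by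
  simp only [Matrix.mul_apply]
  exact Finset.measurable_sum _ fun e _ => (hR a e).mul (measurable_matrix_inv_apply hW e b)

end MatrixMeasurability

section Residuals

variable {q : ℕ} {P₀ : Measure (Fin q → ℝ)} {r s : Finset (Fin q)} {ι κ : Type*}
  {x : ι → (Fin q → ℝ) → ℝ} {y : κ → (Fin q → ℝ) → ℝ}

theorem coordSigma_le (s : Finset (Fin q)) : coordSigma s ≤ MeasurableSpace.pi :=
  Measurable.comap_le (by fun_prop)

theorem coordSigma_mono (h : r ⊆ s) : coordSigma r ≤ coordSigma s := by
  refine MeasurableSpace.comap_le_iff_le_map.2 ?_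
  have : Measurable[coordSigma s] fun (z : Fin q → ℝ) (i : r) => z i := by
    refine @measurable_pi_lambda _ _ _ (coordSigma s) _ _ fun i => ?_
    have h1 := comap_measurable (m := MeasurableSpace.pi) (fun (z : Fin q → ℝ) (i : s) => z i)
    exact (measurable_pi_apply (⟨i, h i.2⟩ : s)).comp h1
  exact this.le_map

theorem measurable_condMatrix (s : Finset (Fin q)) (a : ι) (c : κ) :
    Measurable[coordSigma s] fun z => condMatrix P₀ (coordSigma s) x y z a c :=
  (stronglyMeasurable_condExp (m := coordSigma s)).measurable

variable [Fintype κ] [DecidableEq κ]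

/-- The coefficients of the conditional linear projection of `x` on `y` given the coordinates
in `s`. -/
noncomputable def condCoeff (P₀ : Measure (Fin q → ℝ)) (s : Finset (Fin q))
    (x : ι → (Fin q → ℝ) → ℝ) (y : κ → (Fin q → ℝ) → ℝ) (z : Fin q → ℝ) : Matrix ι κ ℝ :=
  condMatrix P₀ (coordSigma s) x y z * (condMatrix P₀ (coordSigma s) y y z)⁻¹

theorem measurable_condCoeff (s : Finset (Fin q)) (a : ι) (c : κ) :
    Measurable[coordSigma s] fun z => condCoeff P₀ s x y z a c := by
  exact measurable_matrix_mul_inv_apply (mΩ := coordSigma s)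
    (fun _ _ => measurable_condMatrix s _ _) (fun _ _ => measurable_condMatrix s _ _) a c

theorem HasBoundedInverse.essBounded
    (h : HasBoundedInverse P₀ (coordSigma s) y) (a c : κ) :
    EssBounded P₀ fun z => (condMatrix P₀ (coordSigma s) y y z)⁻¹ a c := by
  obtain ⟨C, hC⟩ := h
  exact ⟨C, hC.mono fun z hz => hz.2 a c⟩

theorem essBounded_condCoeff (hx : ∀ a, EssBounded P₀ (x a))
    (hy : ∀ c, EssBounded P₀ (y c)) (h : HasBoundedInverse P₀ (coordSigma s) y) (a : ι) (c : κ) :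
    EssBounded P₀ fun z => condCoeff P₀ s x y z a c := by
  simp only [condCoeff, Matrix.mul_apply]
  exact EssBounded.sum fun e => ((hx a).mul (hy e)).condExp _ |>.mul (h.essBounded e c)

/-- The residual of the conditional linear projection of `x` on `y` given the coordinates in `s`. -/
noncomputable def condResidual (P₀ : Measure (Fin q → ℝ)) (s : Finset (Fin q))
    (x : ι → (Fin q → ℝ) → ℝ) (y : κ → (Fin q → ℝ) → ℝ) (a : ι) (z : Fin q → ℝ) : ℝ :=
  x a z - ∑ c, condCoeff P₀ s x y z a c * y c z

theorem measurable_condResidual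
    (hx : ∀ a, Measurable (x a)) (hy : ∀ c, Measurable (y c)) (a : ι) :
    Measurable (condResidual P₀ s x y a) :=
  (hx a).sub (Finset.measurable_sum _ fun c _ =>
    ((measurable_condCoeff s a c).mono (coordSigma_le s) le_rfl).mul (hy c))

theorem essBounded_condResidual
    (hx : ∀ a, EssBounded P₀ (x a)) (hy : ∀ c, EssBounded P₀ (y c))
    (h : HasBoundedInverse P₀ (coordSigma s) y) (a : ι) : EssBounded P₀ (condResidual P₀ s x y a) :=
  (hx a).sub (EssBounded.sum fun c => (essBounded_condCoeff hx hy h a c).mul (hy c))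

variable [IsProbabilityMeasure P₀]

/-- The normal equations: the residual is orthogonal to the regressors, conditionally on the
coordinates in `s`. -/
theorem condExp_condResidual_mul
    (hxm : ∀ a, Measurable (x a)) (hym : ∀ c, Measurable (y c))
    (hx : ∀ a, EssBounded P₀ (x a)) (hy : ∀ c, EssBounded P₀ (y c))
    (h : HasBoundedInverse P₀ (coordSigma s) y) (a : ι) (c : κ) :
    P₀[fun z => condResidual P₀ s x y a z * y c z | coordSigma s] =ᵐ[P₀] 0 := by
  have hyy : ∀ e, Integrable (fun z => y e z * y c z) P₀ := fun e =>
    (hy e).integrable_mul (hym e).aestronglyMeasurable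
      (((hy c).memLp (hym c).aestronglyMeasurable).integrable (by norm_num))
  have hxy : Integrable (fun z => x a z * y c z) P₀ :=
    (hx a).integrable_mul (hxm a).aestronglyMeasurable
      (((hy c).memLp (hym c).aestronglyMeasurable).integrable (by norm_num))
  have hΛm : ∀ e, StronglyMeasurable[coordSigma s] fun z => condCoeff P₀ s x y z a e := fun e =>
    (measurable_condCoeff s a e).stronglyMeasurable
  have hΛ : ∀ e, Integrable (fun z => condCoeff P₀ s x y z a e * (y e z * y c z)) P₀ := fun e =>
    (essBounded_condCoeff hx hy h a e).integrable_mul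
      ((hΛm e).mono (coordSigma_le s)).aestronglyMeasurable (hyy e)
  have e1 : (fun z => condResidual P₀ s x y a z * y c z)
      = (fun z => x a z * y c z) - ∑ e, fun z => condCoeff P₀ s x y z a e * (y e z * y c z) := by
    funext z
    simp only [condResidual, Pi.sub_apply, Finset.sum_apply, sub_mul, Finset.sum_mul, mul_assoc]
  rw [e1]
  have h1 : ∀ e, P₀[fun z => condCoeff P₀ s x y z a e * (y e z * y c z) | coordSigma s] =ᵐ[P₀]
      fun z => condCoeff P₀ s x y z a e * condMatrix P₀ (coordSigma s) y y z e c := fun e =>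
    condExp_mul_of_stronglyMeasurable_left (hΛm e) (hΛ e) (hyy e)
  obtain ⟨_, hinv⟩ := h
  filter_upwards [condExp_sub hxy (integrable_finsetSum' _ fun e _ => hΛ e) (coordSigma s),
    condExp_finsetSum (s := Finset.univ) (fun e _ => hΛ e) (coordSigma s), ae_all_iff.2 h1, hinv]
    with z h2 h3 h4 h5
  rw [h2, Pi.sub_apply, h3, Finset.sum_apply, Finset.sum_congr rfl fun e _ => h4 e]
  have h6 : (condCoeff P₀ s x y z * condMatrix P₀ (coordSigma s) y y z) a c
      = condMatrix P₀ (coordSigma s) x y z a c := by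
    rw [condCoeff, Matrix.mul_assoc, Matrix.nonsing_inv_mul _ h5.1, Matrix.mul_one]
  rw [Matrix.mul_apply] at h6
  rw [h6, Pi.zero_apply, sub_eq_zero]
  rfl

/-- The conditional covariance of a residual with the regressand is that with the residual. -/
theorem condExp_condResidual_mul_self (hrs : r ⊆ s)
    (hxm : ∀ a, Measurable (x a)) (hym : ∀ c, Measurable (y c))
    (hx : ∀ a, EssBounded P₀ (x a)) (hy : ∀ c, EssBounded P₀ (y c))
    (h : HasBoundedInverse P₀ (coordSigma s) y) (a b : ι) :
    P₀[fun z => condResidual P₀ s x y a z * x b z | coordSigma r] =ᵐ[P₀]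
      P₀[fun z => condResidual P₀ s x y a z * condResidual P₀ s x y b z | coordSigma r] := by
  set ρ := condResidual P₀ s x y with hρ
  have hρm : ∀ a, Measurable (ρ a) := measurable_condResidual hxm hym
  have hρb : ∀ a, EssBounded P₀ (ρ a) := essBounded_condResidual hx hy h
  have hρi : ∀ a, Integrable (ρ a) P₀ := fun a =>
    ((hρb a).memLp (hρm a).aestronglyMeasurable).integrable (by norm_num)
  have hρρ : Integrable (fun z => ρ a z * ρ b z) P₀ :=
    (hρb a).integrable_mul (hρm a).aestronglyMeasurable (hρi b)
  have hρy : ∀ c, Integrable (fun z => ρ a z * y c z) P₀ := fun c =>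
    (hρb a).integrable_mul (hρm a).aestronglyMeasurable
      (((hy c).memLp (hym c).aestronglyMeasurable).integrable (by norm_num))
  have hΛm : ∀ e, StronglyMeasurable[coordSigma s] fun z => condCoeff P₀ s x y z b e := fun e =>
    (measurable_condCoeff s b e).stronglyMeasurable
  have hΛ : ∀ c, Integrable (fun z => condCoeff P₀ s x y z b c * (ρ a z * y c z)) P₀ := fun c =>
    (essBounded_condCoeff hx hy h b c).integrable_mul
      ((hΛm c).mono (coordSigma_le s)).aestronglyMeasurable (hρy c)
  have e1 : (fun z => ρ a z * x b z) = (fun z => ρ a z * ρ b z)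
      + ∑ c, fun z => condCoeff P₀ s x y z b c * (ρ a z * y c z) := by
    funext z
    have : x b z = ρ b z + ∑ c, condCoeff P₀ s x y z b c * y c z := by
      rw [hρ, condResidual]; ring
    rw [this, mul_add, Finset.mul_sum, Pi.add_apply, Finset.sum_apply]
    congr 1
    exact Finset.sum_congr rfl fun c _ => by ring
  rw [e1]
  have h0 : ∀ c, P₀[fun z => condCoeff P₀ s x y z b c * (ρ a z * y c z) | coordSigma r]
      =ᵐ[P₀] 0 := fun c =>
    condExp_mul_eq_zero (coordSigma_mono hrs) (coordSigma_le s) (hΛm c)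
      (essBounded_condCoeff hx hy h b c) (hρy c) (condExp_condResidual_mul hxm hym hx hy h a c)
  filter_upwards [condExp_add hρρ (integrable_finsetSum' _ fun c _ => hΛ c) (coordSigma r),
    condExp_finsetSum (s := Finset.univ) (fun c _ => hΛ c) (coordSigma r), ae_all_iff.2 h0]
    with z h1 h2 h3
  rw [h1, Pi.add_apply, h2, Finset.sum_apply, Finset.sum_congr rfl fun c _ => h3 c]
  simp

end Residuals

section Biorthogonal

variable {q d J : ℕ} {p : Fin J → ℕ} {P₀ : Measure (Fin q → ℝ)} {θ₀ : Fin d → ℝ}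
  {X : Fin J → Finset (Fin q)} {g : (j : Fin J) → (Fin q → ℝ) → (Fin d → ℝ) → Fin (p j) → ℝ}
  {A : Set (Fin q → ℝ)}

theorem subset_allCoords (X : Fin J → Finset (Fin q)) (j : Fin J) : X j ⊆ allCoords X :=
  Finset.subset_biUnion_of_mem X (Finset.mem_univ j)

theorem residual_eq_condResidual (j : Fin J) :
    residual P₀ θ₀ X g A j = condResidual P₀ (allCoords X) (truncated θ₀ g A j)
      (truncatedOthers θ₀ g A j) := by
  funext i z
  rfl

theorem measurable_truncated (hg : ∀ j θ i, Measurable fun z => g j z θ i) (hA : MeasurableSet A)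
    (j : Fin J) (i : Fin (p j)) : Measurable (truncated θ₀ g A j i) :=
  (hg j θ₀ i).indicator hA

/-- The residuals vanish off `A`, so that truncating a factor has no effect. -/
theorem residual_mul (j : Fin J) (i : Fin (p j)) (l : Fin J) (k : Fin (p l)) (z : Fin q → ℝ) :
    residual P₀ θ₀ X g A j i z * g l z θ₀ k
      = residual P₀ θ₀ X g A j i z * truncated θ₀ g A l k z := by
  by_cases hz : z ∈ A
  · simp [truncated, hz]
  · have h0 : residual P₀ θ₀ X g A j i z = 0 := by
      rw [residual_eq_condResidual, condResidual]
      simp [truncated, truncatedOthers, hz]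
    rw [h0, zero_mul, zero_mul]

theorem measurable_truncatedOthers (hg : ∀ j θ i, Measurable fun z => g j z θ i)
    (hA : MeasurableSet A) (j : Fin J) (c : {a : (l : Fin J) × Fin (p l) // a.1 ≠ j}) :
    Measurable (truncatedOthers θ₀ g A j c) :=
  measurable_truncated hg hA c.1.1 c.1.2

theorem measurable_residual (hg : ∀ j θ i, Measurable fun z => g j z θ i) (hA : MeasurableSet A)
    (j : Fin J) (i : Fin (p j)) : Measurable (residual P₀ θ₀ X g A j i) := by
  rw [residual_eq_condResidual]
  exact measurable_condResidual (measurable_truncated hg hA j)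
    (measurable_truncatedOthers hg hA j) i

theorem essBounded_residual (hb : ∀ j i, EssBounded P₀ (truncated θ₀ g A j i)) {j : Fin J}
    (hW : HasBoundedInverse P₀ (coordSigma (allCoords X)) (truncatedOthers θ₀ g A j))
    (i : Fin (p j)) : EssBounded P₀ (residual P₀ θ₀ X g A j i) := by
  have hyb : ∀ c, EssBounded P₀ (truncatedOthers θ₀ g A j c) := fun c => hb c.1.1 c.1.2
  rw [residual_eq_condResidual]
  exact essBounded_condResidual (hb j) hyb hW i

variable [IsProbabilityMeasure P₀]

/-- For `ψ` bounded and measurable with respect to the `j`-th conditioning vector, `ψ b_j` is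
orthogonal to all other moment functions, conditionally on their conditioning vectors, and its
conditional covariance with `g_j` is `ψ E[b_j b_j' | X⁽ʲ⁾]`. -/
theorem condExp_mul_residual_mul (hg : ∀ j θ i, Measurable fun z => g j z θ i)
    (hA : MeasurableSet A) (hb : ∀ j i, EssBounded P₀ (truncated θ₀ g A j i))
    (hW : ∀ j, HasBoundedInverse P₀ (coordSigma (allCoords X)) (truncatedOthers θ₀ g A j))
    (j : Fin J) (i : Fin (p j)) {ψ : (Fin q → ℝ) → ℝ}
    (hψ : StronglyMeasurable[coordSigma (X j)] ψ) (hψb : EssBounded P₀ ψ) :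
    (∀ (l : Fin J) (k : Fin (p l)), l ≠ j →
      P₀[fun z => ψ z * (residual P₀ θ₀ X g A j i z * g l z θ₀ k) | coordSigma (X l)] =ᵐ[P₀] 0) ∧
    ∀ k : Fin (p j),
      P₀[fun z => ψ z * (residual P₀ θ₀ X g A j i z * g j z θ₀ k) | coordSigma (X j)] =ᵐ[P₀]
        fun z => ψ z * condMatrix P₀ (coordSigma (X j)) (residual P₀ θ₀ X g A j)
          (residual P₀ θ₀ X g A j) z i k := by
  have hxm := measurable_truncated (θ₀ := θ₀) hg hA j
  have hym := measurable_truncatedOthers (θ₀ := θ₀) hg hA j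
  have hyb : ∀ c, EssBounded P₀ (truncatedOthers θ₀ g A j c) := fun c => hb c.1.1 c.1.2
  have hρm : Measurable (residual P₀ θ₀ X g A j i) := measurable_residual hg hA j i
  have hρb : EssBounded P₀ (residual P₀ θ₀ X g A j i) := essBounded_residual hb (hW j) i
  have hint : ∀ (l : Fin J) (k : Fin (p l)),
      Integrable (fun z => residual P₀ θ₀ X g A j i z * truncated θ₀ g A l k z) P₀ := fun l k =>
    hρb.integrable_mul hρm.aestronglyMeasurable (((hb l k).memLp
      (measurable_truncated hg hA l k).aestronglyMeasurable).integrable (by norm_num))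
  simp only [residual_mul]
  constructor
  · intro l k hlj
    refine condExp_mul_eq_zero (coordSigma_mono (subset_allCoords X l)) (coordSigma_le _)
      (hψ.mono (coordSigma_mono (subset_allCoords X j))) hψb (hint l k) ?_
    rw [residual_eq_condResidual]
    exact condExp_condResidual_mul hxm hym (hb j) hyb (hW j) i ⟨⟨l, k⟩, hlj⟩
  · intro k
    have h1 := condExp_mul_of_stronglyMeasurable_left hψ
      (hψb.integrable_mul (hψ.mono (coordSigma_le _)).aestronglyMeasurable (hint j k)) (hint j k)
    have h2 := condExp_condResidual_mul_self (subset_allCoords X j) hxm hym (hb j) hyb (hW j) i k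
    rw [← residual_eq_condResidual] at h2
    filter_upwards [h1, h2] with z h1 h2
    refine h1.trans ?_
    rw [Pi.mul_apply, h2]
    rfl

/-- Under Assumption T, the family `E[b_j b_j' | X⁽ʲ⁾]⁻¹ b_j` is biorthogonal to the moment
functions. -/
theorem AssumptionT.exists_isBiorthogonal (hg : ∀ j θ i, Measurable fun z => g j z θ i)
    (hgL2 : ∀ j i, MemLp (fun z => g j z θ₀ i) 2 P₀) (hT : AssumptionT P₀ θ₀ X g) :
    ∃ β, IsBiorthogonal P₀ (fun a : (j : Fin J) × Fin (p j) => coordSigma (X a.1))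
      (fun a z => stacked g a z θ₀) β := by
  obtain ⟨A, hA, ⟨B, hB⟩, hW, hV⟩ := hT
  have hb : ∀ j i, EssBounded P₀ (truncated θ₀ g A j i) := fun j i => ⟨B, hB j i⟩
  have hρm : ∀ j i, Measurable (residual P₀ θ₀ X g A j i) := measurable_residual hg hA
  have hρb : ∀ j i, EssBounded P₀ (residual P₀ θ₀ X g A j i) := fun j =>
    essBounded_residual hb (hW j)
  set V : (j : Fin J) → (Fin q → ℝ) → Matrix (Fin (p j)) (Fin (p j)) ℝ := fun j =>
    condMatrix P₀ (coordSigma (X j)) (residual P₀ θ₀ X g A j) (residual P₀ θ₀ X g A j) with hVdef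
  have hVm : ∀ j i k, StronglyMeasurable[coordSigma (X j)] fun z => (V j z)⁻¹ i k := fun j i k =>
    (measurable_matrix_inv_apply (mΩ := coordSigma (X j))
      (fun _ _ => measurable_condMatrix (X j) _ _) i k).stronglyMeasurable
  have hVb : ∀ j i k, EssBounded P₀ fun z => (V j z)⁻¹ i k := fun j i k => (hV j).essBounded i k
  refine ⟨fun a z => ∑ k, (V a.1 z)⁻¹ a.2 k * residual P₀ θ₀ X g A a.1 k z, ?_, ?_, ?_⟩
  · intro a
    refine Measurable.aestronglyMeasurable (Finset.measurable_sum _ fun k _ => ?_)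
    exact ((hVm a.1 a.2 k).mono (coordSigma_le _)).measurable.mul (hρm a.1 k)
  · exact fun a => EssBounded.sum fun k => (hVb a.1 a.2 k).mul (hρb a.1 k)
  · rintro ⟨j, i⟩ ⟨l, k⟩ φ hφ hφb
    have hψ : ∀ e, StronglyMeasurable[coordSigma (X j)] fun z => φ z * (V j z)⁻¹ i e := fun e =>
      hφ.mul (hVm j i e)
    have hψb : ∀ e, EssBounded P₀ fun z => φ z * (V j z)⁻¹ i e := fun e =>
      EssBounded.mul hφb (hVb j i e)
    have hint : ∀ e, Integrable (fun z => φ z * (V j z)⁻¹ i e *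
        (residual P₀ θ₀ X g A j e z * g l z θ₀ k)) P₀ := fun e =>
      (hψb e).integrable_mul ((hψ e).mono (coordSigma_le _)).aestronglyMeasurable
        ((hρb j e).integrable_mul (hρm j e).aestronglyMeasurable
          ((hgL2 l k).integrable (by norm_num)))
    have e1 : (fun z => φ z * (∑ e, (V j z)⁻¹ i e * residual P₀ θ₀ X g A j e z)
        * stacked g ⟨l, k⟩ z θ₀) = ∑ e, fun z => φ z * (V j z)⁻¹ i e *
        (residual P₀ θ₀ X g A j e z * g l z θ₀ k) := by
      funext z
      rw [Finset.sum_apply, Finset.mul_sum, Finset.sum_mul]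
      exact Finset.sum_congr rfl fun e _ => by rw [stacked]; ring
    have hkey := fun e => condExp_mul_residual_mul hg hA hb hW j e (hψ e) (hψb e)
    change P₀[fun z => φ z * (∑ e, (V j z)⁻¹ i e * residual P₀ θ₀ X g A j e z)
        * stacked g ⟨l, k⟩ z θ₀ | coordSigma (X l)] =ᵐ[P₀] _
    rw [e1]
    refine (condExp_finsetSum (fun e _ => hint e) _).trans ?_
    by_cases hlj : l = j
    · subst hlj
      obtain ⟨_, hinv⟩ := hV l
      filter_upwards [ae_all_iff.2 fun e => (hkey e).2 k, hinv] with z h1 h2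
      rw [Finset.sum_apply, Finset.sum_congr rfl fun e _ => h1 e]
      have h3 : ∑ e, φ z * (V l z)⁻¹ i e * V l z e k
          = φ z * (1 : Matrix (Fin (p l)) (Fin (p l)) ℝ) i k := by
        rw [← Matrix.nonsing_inv_mul (V l z) h2.1, Matrix.mul_apply, Finset.mul_sum]
        exact Finset.sum_congr rfl fun e _ => by ring
      refine h3.trans ?_
      by_cases hik : i = k
      · subst hik; simp
      · simp [Matrix.one_apply_ne hik, hik]
    · have hne : (⟨j, i⟩ : (j : Fin J) × Fin (p j)) ≠ ⟨l, k⟩ := fun h =>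
        hlj (congrArg Sigma.fst h).symm
      filter_upwards [ae_all_iff.2 fun e => (hkey e).1 l k hlj] with z h1
      rw [Finset.sum_apply, Finset.sum_congr rfl fun e _ => h1 e, if_neg hne]
      simp

end Biorthogonal

/-! ### The information in the conditional model as a limit -/

section Conditional

variable {q d J : ℕ} {p : Fin J → ℕ} {μ P₀ : Measure (Fin q → ℝ)}
  {Θ : Set (Fin d → ℝ)} {θ₀ : Fin d → ℝ} {X : Fin J → Finset (Fin q)}
  {g : (j : Fin J) → (Fin q → ℝ) → (Fin d → ℝ) → Fin (p j) → ℝ} {w : ℕ → (Fin q → ℝ) → ℝ}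

theorem IsRegularSubmodel.mem_base {ι E : Type*} [NormedAddCommGroup E] [NormedSpace ℝ E]
    {P : Measure (Fin q → ℝ)} {M : Set ((Fin d → ℝ) × Measure (Fin q → ℝ))}
    {m : ι → (Fin q → ℝ) → (Fin d → ℝ) → ℝ} {ϑ : E → Fin d → ℝ} {Q : E → Measure (Fin q → ℝ)}
    {D : E →L[ℝ] (Fin d → ℝ)} {S : E →L[ℝ] Lp ℝ 2 P}
    (h : IsRegularSubmodel μ P θ₀ M m ϑ Q D S) : (θ₀, P) ∈ M := by
  have := h.mem.self_of_nhds
  rwa [h.theta_zero, h.law_zero] at this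

theorem measurable_instrumented (hg : ∀ j θ i, Measurable fun z => g j z θ i) (k : ℕ)
    (a : Fin k × ((j : Fin J) × Fin (p j))) (θ : Fin d → ℝ) :
    Measurable fun z => instrumented P₀ X g w k a z θ :=
  ((stronglyMeasurable_condExp (m := coordSigma (X a.2.1))).mono (coordSigma_le _)).measurable.mul
    (hg a.2.1 θ a.2.2)

variable [IsProbabilityMeasure P₀]

theorem memLp_instrumented (hg : ∀ j θ i, Measurable fun z => g j z θ i)
    (hgL2 : ∀ j i, MemLp (fun z => g j z θ₀ i) 2 P₀)
    (hvar : ∀ j i, ∃ C : ℝ, ∀ᵐ z ∂P₀, (P₀[fun y => g j y θ₀ i ^ 2 | coordSigma (X j)]) z ≤ C)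
    (hw : ∀ s, MemLp (w s) 2 P₀) (k : ℕ) (a : Fin k × ((j : Fin J) × Fin (p j))) :
    MemLp (fun z => instrumented P₀ X g w k a z θ₀) 2 P₀ := by
  obtain ⟨C, hC⟩ := hvar a.2.1 a.2.2
  exact (memLp_mul_of_condExp_sq_le (coordSigma_le _) (hg a.2.1 θ₀ a.2.2) (hgL2 a.2.1 a.2.2) hC
    stronglyMeasurable_condExp ((hw a.1).condExp (by norm_num))).1

theorem monotone_oneSpan_instrumented
    (hm : ∀ k a, MemLp (fun z => instrumented P₀ X g w k a z θ₀) 2 P₀) :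
    Monotone fun k => oneSpan P₀ (momentLp (hm k)) := by
  intro k k' hk
  refine Submodule.span_mono (Set.insert_subset_insert ?_)
  rintro _ ⟨a, rfl⟩
  exact ⟨(Fin.castLE hk a.1, a.2), rfl⟩

/-- The directions orthogonal to the moment functions of all the unconditional models are the
nuisance scores of the conditional model. -/
theorem isNuisance_iff (hg : ∀ j θ i, Measurable fun z => g j z θ i)
    (hgL2 : ∀ j i, MemLp (fun z => g j z θ₀ i) 2 P₀)
    (hvar : ∀ j i, ∃ C : ℝ, ∀ᵐ z ∂P₀, (P₀[fun y => g j y θ₀ i ^ 2 | coordSigma (X j)]) z ≤ C)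
    (hw : ∀ s, MemLp (w s) 2 P₀)
    (hspan : (Submodule.span ℝ (Set.range fun s => (hw s).toLp (w s))).topologicalClosure = ⊤)
    (hm : ∀ k a, MemLp (fun z => instrumented P₀ X g w k a z θ₀) 2 P₀) (h : Lp ℝ 2 P₀) :
    h ∈ (⨆ k, oneSpan P₀ (momentLp (hm k))).topologicalClosureᗮ ↔
      IsNuisance P₀ (fun a : (j : Fin J) × Fin (p j) => coordSigma (X a.1))
        (fun a z => stacked g a z θ₀) h := by
  rw [Submodule.orthogonal_closure, ← Submodule.iInf_orthogonal, Submodule.mem_iInf]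
  simp only [mem_orthogonal_oneSpan, inner_oneLp, momentLp, inner_toLp_left]
  constructor
  · refine fun H => ⟨(H 0).1, fun a => ?_⟩
    obtain ⟨C, hC⟩ := hvar a.1 a.2
    exact condExp_eq_zero_of_instruments (coordSigma_le _) (hg a.1 θ₀ a.2) (hgL2 a.1 a.2) hC hw
      hspan (Lp.memLp h) fun s => (H (s + 1)).2 (Fin.last s, a)
  · refine fun H k => ⟨H.1, fun a => ?_⟩
    have h1 : Integrable (fun z => stacked g a.2 z θ₀ * h z) P₀ :=
      (hgL2 a.2.1 a.2.2).integrable_mul (Lp.memLp h)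
    have h2 : Integrable (fun z => (P₀[w a.1 | coordSigma (X a.2.1)]) z
        * (stacked g a.2 z θ₀ * h z)) P₀ := by
      simp only [← mul_assoc]
      exact (hm k a).integrable_mul (Lp.memLp h)
    have := integral_mul_eq_zero_of_condExp (coordSigma_le _) stronglyMeasurable_condExp h2 h1
      (H.2 a.2)
    simp only [← mul_assoc] at this
    exact this

variable [SigmaFinite μ]

/-- In the conditional model, the score of a submodel differs from the score for `θ`, in the
direction in which `θ` moves, by a nuisance score. -/
theorem isNuisance_score_sub (hg : ∀ j θ i, Measurable fun z => g j z θ i)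
    (hgL2 : ∀ j i, MemLp (fun z => g j z θ₀ i) 2 P₀)
    {Q : (Fin d → ℝ) → Measure (Fin q → ℝ)} {S : (Fin d → ℝ) →L[ℝ] Lp ℝ 2 P₀}
    (h : IsRegularSubmodel μ P₀ θ₀ (conditionalModel μ Θ X g) (stacked g) (fun u => θ₀ + u) Q
      (ContinuousLinearMap.id ℝ (Fin d → ℝ)) S) {v : Fin d → ℝ} {s : Lp ℝ 2 P₀}
    (hs : IsTangent μ P₀ θ₀ (conditionalModel μ Θ X g) (stacked g) v s) :
    IsNuisance P₀ (fun a : (j : Fin J) × Fin (p j) => coordSigma (X a.1))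
      (fun a z => stacked g a z θ₀) (s - S v) := by
  obtain ⟨ϑ, P, D, S', h', rfl, rfl⟩ := hs
  have hM : ∀ x ∈ conditionalModel μ Θ X g, IsProbabilityMeasure x.2 ∧ x.2 ≪ μ :=
    fun x hx => ⟨hx.2.1, hx.2.2.1⟩
  refine ⟨?_, fun a => condExp_ae_eq_zero (coordSigma_le _)
    ((hgL2 a.1 a.2).integrable_mul (Lp.memLp _)) fun B hB => ?_⟩
  · rw [← inner_oneLp, inner_sub_right, h'.inner_one_score hM, h.inner_one_score hM, sub_zero]
  · have := (h.indicator_moment a.1 a.2 hB).inner_moment_score_sub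
      (h'.indicator_moment a.1 a.2 hB)
      (fun _ θ => (hg a.1 θ a.2).indicator (coordSigma_le _ _ hB)) ()
    rw [← this, ← integral_indicator (coordSigma_le _ _ hB)]
    congr 1
    funext z
    by_cases hz : z ∈ B <;> simp [hz, stacked]

theorem nuisance_mem_tangentSpace (hg : ∀ j θ i, Measurable fun z => g j z θ i)
    (hP₀ : (θ₀, P₀) ∈ conditionalModel μ Θ X g)
    (hgL2 : ∀ j i, MemLp (fun z => g j z θ₀ i) 2 P₀)
    (hvar : ∀ j i, ∃ C : ℝ, ∀ᵐ z ∂P₀, (P₀[fun y => g j y θ₀ i ^ 2 | coordSigma (X j)]) z ≤ C)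
    (hT : AssumptionT P₀ θ₀ X g) {h : Lp ℝ 2 P₀}
    (hh : IsNuisance P₀ (fun a : (j : Fin J) × Fin (p j) => coordSigma (X a.1))
      (fun a z => stacked g a z θ₀) h) :
    h ∈ tangentSpace μ P₀ θ₀ (conditionalModel μ Θ X g) (stacked g) := by
  obtain ⟨β, hβ⟩ := hT.exists_isBiorthogonal hg hgL2
  have hcl := hh.mem_closure (κ := (j : Fin J) × Fin (p j)) (fun _ => coordSigma_le _)
    (fun a => hg a.1 θ₀ a.2) (fun a => hgL2 a.1 a.2) (fun a => (hP₀.2.2.2 a.1 a.2).2)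
    (fun a => hvar a.1 a.2) hβ
  refine closure_mono ?_ hcl
  rintro f ⟨hfb, hf⟩
  exact Submodule.subset_span ⟨0, isTangent_conditionalModel hP₀ hgL2 f hfb hf.1
    fun j i => hf.2 ⟨j, i⟩⟩

end Conditional

end CondMoment

open CondMoment in
theorem theorem1 {q d J : ℕ} {p : Fin J → ℕ}
    (μ P₀ : Measure (Fin q → ℝ)) [SigmaFinite μ] [IsProbabilityMeasure P₀]
    (Θ : Set (Fin d → ℝ)) (θ₀ : Fin d → ℝ) (X : Fin J → Finset (Fin q))
    (g : (j : Fin J) → (Fin q → ℝ) → (Fin d → ℝ) → Fin (p j) → ℝ)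
    (hg : ∀ j θ i, Measurable fun z => g j z θ i)
    (hP₀ : (θ₀, P₀) ∈ CondMoment.conditionalModel μ Θ X g)
    (hgL2 : ∀ j i, MemLp (fun z => g j z θ₀ i) 2 P₀)
    (hvar : ∀ j i, ∃ C : ℝ, ∀ᵐ z ∂P₀,
      (P₀[fun y => g j y θ₀ i ^ 2 | CondMoment.coordSigma (X j)]) z ≤ C)
    (w : ℕ → (Fin q → ℝ) → ℝ) (hw : ∀ s, MemLp (w s) 2 P₀)
    (hspan : (Submodule.span ℝ (Set.range fun s => (hw s).toLp (w s))).topologicalClosure = ⊤)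
    (hT : CondMoment.AssumptionT P₀ θ₀ X g)
    (hSP : CondMoment.AssumptionSP μ P₀ Θ θ₀ X g w)
    (G : (k : ℕ) → Matrix (Fin k × ((j : Fin J) × Fin (p j))) (Fin k × ((j : Fin J) × Fin (p j))) ℝ)
    (hG : ∀ k, CondMoment.IsGeneralizedInverse
      (CondMoment.momentVariance P₀ θ₀ (CondMoment.instrumented P₀ X g w k)) (G k))
    (hns : ∀ k, 1 ≤ k → IsUnit
      (CondMoment.momentInformation P₀ θ₀ (CondMoment.instrumented P₀ X g w k) (G k)).det) :
    (∀ k, ∀ a, DifferentiableAt ℝ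
      (fun θ => ∫ z, CondMoment.instrumented P₀ X g w k a z θ ∂P₀) θ₀) ∧
    (∀ k, 1 ≤ k → CondMoment.IsInformation μ P₀ θ₀
      (CondMoment.unconditionalModel μ Θ (CondMoment.instrumented P₀ X g w k))
      (CondMoment.instrumented P₀ X g w k)
      (CondMoment.momentInformation P₀ θ₀ (CondMoment.instrumented P₀ X g w k) (G k))) ∧
    ∃ I : Matrix (Fin d) (Fin d) ℝ,
      CondMoment.IsInformation μ P₀ θ₀ (CondMoment.conditionalModel μ Θ X g)
        (CondMoment.stacked g) I ∧
      Tendsto (fun k => CondMoment.momentInformation P₀ θ₀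
        (CondMoment.instrumented P₀ X g w k) (G k)) atTop (𝓝 I) := by
  have hmeas := fun k a θ => measurable_instrumented (P₀ := P₀) (X := X) (w := w) hg k a θ
  have hm := memLp_instrumented (X := X) hg hgL2 hvar hw
  obtain ⟨Q, S, hS, hSk⟩ := hSP
  set K : ℕ → Submodule ℝ (Lp ℝ 2 P₀) := fun k => oneSpan P₀ (momentLp (hm k)) with hK
  have hinfo : ∀ k, 1 ≤ k → momentInformation P₀ θ₀ (instrumented P₀ X g w k) (G k)
      = Matrix.gram ℝ fun l => (K k).starProjection (S (Pi.single l 1)) := fun k hk =>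
    momentInformation_eq_gram (hSk k hk) (hSk k hk).mem_base (hmeas k) (hG k)
  refine ⟨fun k a => ?_, fun k hk => ?_, ?_⟩
  · have hk : 1 ≤ k := Nat.one_le_iff_ne_zero.2 fun h0 => (h0 ▸ a.1 : Fin 0).elim0
    exact ((hSk k hk).hasFDerivAt_moment_theta (hmeas k) a).differentiableAt
  · exact isInformation_unconditionalModel (hSk k hk) (hSk k hk).mem_base (hmeas k) (hG k)
      (hns k hk)
  · have hcomp : CompleteSpace (⨆ k, K k).topologicalClosure :=
      (Submodule.isClosed_topologicalClosure _).completeSpace_coe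
    have hKmono : Monotone K := monotone_oneSpan_instrumented hm
    have hnuis := isNuisance_iff hg hgL2 hvar hw hspan hm
    refine ⟨_, isInformation_gram_starProjection (K := (⨆ k, K k).topologicalClosure) S
      hS.isTangent (fun v s hs => (hnuis _).2 (isNuisance_score_sub hg hgL2 hS hs))
      (fun h hh => nuisance_mem_tangentSpace hg hP₀ hgL2 hvar hT ((hnuis h).1 hh)) ?_, ?_⟩
    · refine isUnit_det_gram_starProjection_mono
        ((le_iSup K 1).trans (Submodule.le_topologicalClosure _)) _ ?_
      rw [← hinfo 1 le_rfl]
      exact hns 1 le_rfl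
    · have hlim : Tendsto (fun k => Matrix.gram ℝ fun l => (K k).starProjection
          (S (Pi.single l 1))) atTop (𝓝 (Matrix.gram ℝ fun l : Fin d =>
            (⨆ k, K k).topologicalClosure.starProjection (S (Pi.single l 1)))) := by
        refine tendsto_pi_nhds.2 fun l => tendsto_pi_nhds.2 fun l' => ?_
        exact (Submodule.starProjection_tendsto_closure_iSup K hKmono _).inner
          (Submodule.starProjection_tendsto_closure_iSup K hKmono _)
      refine hlim.congr' ?_
      filter_upwards [eventually_ge_atTop 1] with k hk
      exact (hinfo k hk).symm
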